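/- Let $n>2$ be an integer. Let $f:\mathbb R\times(0,\infty)\to\mathbb R$, $f=f(u,r)$, be continuous and differentiable in $u$. Let $h:(0,\infty)\to\mathbb R$ be differentiable and satisfy $$\textbf{H}:\quad h(r)<\tfrac{(n-2)^2}{4}\ (r>0),\quad \lim_{r\to0^+}h(r)=\eta<\tfrac{(n-2)^2}{4},\quad \lim_{r\to\infty}h(r)=\beta<\tfrac{(n-2)^2}{4},\quad \tfrac{h(r)-\eta}{r}\in L^1(0,1],\quad \tfrac{h(r)-\beta}{r}\in L^1[1,\infty).$$ For $l>2$ put $\alpha_l=\frac{2}{l-2}$, $\gamma_l=\alpha_l+2-n$, $g_l(x,t)=f(xe^{-\alpha_l t},e^t)\,e^{(\alpha_l+2)t}$, and consider the planar non-autonomous system $$(\mathrm S_l)\qquad \dot x=\alpha_l x+y,\qquad \dot y=-h(e^t)\,x+\gamma_l\, y-g_l(x,t).$$ For $\theta<\frac{(n-2)^2}{4}$ put $$2_*(\theta)=2\,\frac{n+\sqrt{(n-2)^2-4\theta}}{n-2+\sqrt{(n-2)^2-4\theta}},\qquad I(\theta)=\begin{cases}+\infty&\theta\le0,\\ 2\,\frac{n-\sqrt{(n-2)^2-4\theta}}{n-2-\sqrt{(n-2)^2-4\theta}}&\theta>0.\end{cases}$$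 Assume - $\boldsymbol{gu}$: $l_u\in(2_*(\eta),I(\eta))$; for every $\tau\in\mathbb R$ the functions $g_{l_u}(x,t)$ and $\partial_x g_{l_u}(x,t)$ are continuous in $x$, for $x$ in compact sets, uniformly with respect to $t\le\tau$; and $g_{l_u}(0,t)=\partial_xg_{l_u}(0,t)=0$ for all $t\in\mathbb R$; - $\boldsymbol{gs}$: $l_s\in(2_*(\beta),I(\beta))$; for every $\tau\in\mathbb R$ the functions $g_{l_s}(x,t)$ and $\partial_x g_{l_s}(x,t)$ are continuous in $x$, for $x$ in compact sets, uniformly with respect to $t\ge\tau$; and $g_{l_s}(0,t)=\partial_xg_{l_s}(0,t)=0$ for all $t\in\mathbb R$. No global continuability is assumed: solutions of $(\mathrm S_l)$ may blow up in finite time. For $\tau\in\mathbb R$ let $\tilde W^u_{l_u}(\tau)$ be the set of $\boldsymbol Q\in\mathbb R^2$ such that the solution of $(\mathrm S_{l_u})$ equal to $\boldsymbol Q$ at time $\tau$ exists on $(-\infty,\tau]$ and tends to $(0,0)$ as $t\to-\infty$; let $\tilde W^s_{l_s}(\tau)$ be the set of $\boldsymbol Q\in\mathbb R^2$ such that the solution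 of $(\mathrm S_{l_s})$ equal to $\boldsymbol Q$ at time $\tau$ exists on $[\tau,\infty)$ and tends to $(0,0)$ as $t\to+\infty$. Both sets contain the origin; let $W^u_{l_u}(\tau)$ and $W^s_{l_s}(\tau)$ be their connected components (as subsets of the plane) containing the origin. A *$1$-dimensional immersed manifold* is the image in $\mathbb R^2$ of an injective $C^1$ immersion of a Hausdorff, second countable $1$-dimensional $C^1$ manifold $M$ without boundary. **Lemma.** For every $\tau\in\mathbb R$, the sets $W^u_{l_u}(\tau)\subset\tilde W^u_{l_u}(\tau)$ and $W^s_{l_s}(\tau)\subset\tilde W^s_{l_s}(\tau)$ are connected, contain the origin, and are $1$-dimensional immersed manifolds. Moreover each of them contains a $1$-dimensional immersed manifold which contains the origin and for which $M$ can be taken connected. -/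

import Mathlib

open Set Filter Topology MeasureTheory
open scoped Manifold

namespace Fowler

noncomputable section

/-- `√((n-2)² - 4η)`, which enters the critical exponents of the Hardy potential. -/
def discr (n : ℕ) (η : ℝ) : ℝ := Real.sqrt (((n : ℝ) - 2) ^ 2 - 4 * η)

/-- The (shifted) Serrin exponent `2_*(η)`. -/
def lowerExp (n : ℕ) (η : ℝ) : ℝ :=
  2 * ((n + discr n η) / (n - 2 + discr n η))

/-- The upper exponent `I(η)`, with value `+∞` when `η ≤ 0`. -/
def upperExp (n : ℕ) (η : ℝ) : EReal :=
  if η ≤ 0 then ⊤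
  else ((2 * ((n - discr n η) / (n - 2 - discr n η)) : ℝ) : EReal)

/-- `α_l = 2 / (l - 2)`. -/
def alphaL (l : ℝ) : ℝ := 2 / (l - 2)

/-- `γ_l = α_l + 2 - n`. -/
def gammaL (n : ℕ) (l : ℝ) : ℝ := alphaL l + 2 - n

/-- `g_l(x,t) = f(x e^{-α_l t}, e^t) e^{(α_l+2) t}`. -/
def gL (f : ℝ → ℝ → ℝ) (l x t : ℝ) : ℝ :=
  f (x * Real.exp (-alphaL l * t)) (Real.exp t) * Real.exp ((alphaL l + 2) * t)

/-- The right-hand side at time `t` and point `p = (x, y)` of the planar system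
`ẋ = α_l x + y`, `ẏ = -h(e^t) x + γ_l y - g_l(x,t)`. -/
def field (n : ℕ) (h : ℝ → ℝ) (f : ℝ → ℝ → ℝ) (l t : ℝ) (p : ℝ × ℝ) : ℝ × ℝ :=
  (alphaL l * p.1 + p.2,
    -h (Real.exp t) * p.1 + gammaL n l * p.2 - gL f l p.1 t)

/-- `z` solves the planar system on the interval `I` (one-sided derivatives at endpoints of `I`
that belong to `I`). The values of `z` outside `I` are irrelevant. -/
def IsTrajectoryOn (n : ℕ) (h : ℝ → ℝ) (f : ℝ → ℝ → ℝ) (l : ℝ)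
    (I : Set ℝ) (z : ℝ → ℝ × ℝ) : Prop :=
  ∀ t ∈ I, HasDerivWithinAt z (field n h f l t (z t)) I t

/-- The unstable set at time `τ`: initial data `Q` at time `τ` whose trajectory is defined on
the whole of `(-∞, τ]` and tends to the origin as `t → -∞`. Nothing is asked for `t > τ`. -/
def unstableSet (n : ℕ) (h : ℝ → ℝ) (f : ℝ → ℝ → ℝ) (l τ : ℝ) : Set (ℝ × ℝ) :=
  {Q | ∃ z : ℝ → ℝ × ℝ, IsTrajectoryOn n h f l (Iic τ) z ∧ z τ = Q ∧
    Tendsto z atBot (𝓝 0)}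

/-- The stable set at time `τ`: initial data `Q` at time `τ` whose trajectory is defined on
the whole of `[τ, +∞)` and tends to the origin as `t → +∞`. Nothing is asked for `t < τ`. -/
def stableSet (n : ℕ) (h : ℝ → ℝ) (f : ℝ → ℝ → ℝ) (l τ : ℝ) : Set (ℝ × ℝ) :=
  {Q | ∃ z : ℝ → ℝ × ℝ, IsTrajectoryOn n h f l (Ici τ) z ∧ z τ = Q ∧
    Tendsto z atTop (𝓝 0)}

/-- The standing assumption on the Hardy coefficient `h`, with limits `η` at `0` and `β` at
`+∞`. -/
structure HypH (n : ℕ) (h : ℝ → ℝ) (η β : ℝ) : Prop where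
  differentiable : DifferentiableOn ℝ h (Ioi 0)
  lt : ∀ r, 0 < r → h r < ((n : ℝ) - 2) ^ 2 / 4
  tendsto_zero : Tendsto h (𝓝[>] 0) (𝓝 η)
  eta_lt : η < ((n : ℝ) - 2) ^ 2 / 4
  integrable_zero : IntegrableOn (fun r => (h r - η) / r) (Ioc 0 1)
  tendsto_infty : Tendsto h atTop (𝓝 β)
  beta_lt : β < ((n : ℝ) - 2) ^ 2 / 4
  integrable_infty : IntegrableOn (fun r => (h r - β) / r) (Ici 1)

/-- The standing regularity of the nonlinearity `f(u,r)`, `u ∈ ℝ`, `r > 0`: it is continuous,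
and differentiable in `u`. -/
structure RegularF (f : ℝ → ℝ → ℝ) : Prop where
  continuous : ContinuousOn (fun p : ℝ × ℝ => f p.1 p.2) (univ ×ˢ Ioi 0)
  differentiable : ∀ r, 0 < r → Differentiable ℝ (fun u => f u r)

/-- `G(x,t)` is continuous in `x` uniformly for `t ∈ T`, for `x` in compact sets. -/
def ContUniformlyInTime (G : ℝ → ℝ → ℝ) (T : Set ℝ) : Prop :=
  ∀ K : Set ℝ, IsCompact K → ∀ ε > 0, ∃ δ > 0, ∀ t ∈ T, ∀ x ∈ K, ∀ y ∈ K,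
    |x - y| < δ → |G x t - G y t| < ε

/-- `∂_x g_l(x,t)`. -/
def dgL (f : ℝ → ℝ → ℝ) (l x t : ℝ) : ℝ := deriv (fun ξ => gL f l ξ t) x

/-- Hypothesis `gu` for the exponent `l` (to be used together with `HypH`). -/
structure HypGu (n : ℕ) (f : ℝ → ℝ → ℝ) (η l : ℝ) : Prop where
  lower : lowerExp n η < l
  upper : (l : EReal) < upperExp n η
  unif : ∀ τ : ℝ, ContUniformlyInTime (gL f l) (Iic τ)
  unif_deriv : ∀ τ : ℝ, ContUniformlyInTime (dgL f l) (Iic τ)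
  zero : ∀ t, gL f l 0 t = 0
  deriv_zero : ∀ t, dgL f l 0 t = 0

/-- Hypothesis `gs` for the exponent `l` (to be used together with `HypH`). -/
structure HypGs (n : ℕ) (f : ℝ → ℝ → ℝ) (β l : ℝ) : Prop where
  lower : lowerExp n β < l
  upper : (l : EReal) < upperExp n β
  unif : ∀ τ : ℝ, ContUniformlyInTime (gL f l) (Ici τ)
  unif_deriv : ∀ τ : ℝ, ContUniformlyInTime (dgL f l) (Ici τ)
  zero : ∀ t, gL f l 0 t = 0
  deriv_zero : ∀ t, dgL f l 0 t = 0

/-- `ι` is an injective `C¹` immersion, with image `S`, of the one-dimensional manifold `M`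
(charted on `ℝ`, so without boundary) into the plane. -/
def IsImmersionOnto (M : Type) [TopologicalSpace M] [ChartedSpace ℝ M]
    (ι : M → ℝ × ℝ) (S : Set (ℝ × ℝ)) : Prop :=
  ContMDiff 𝓘(ℝ, ℝ) 𝓘(ℝ, ℝ × ℝ) 1 ι ∧ Function.Injective ι ∧
    (∀ p, Function.Injective (mfderiv 𝓘(ℝ, ℝ) 𝓘(ℝ, ℝ × ℝ) ι p)) ∧ range ι = S

/-- `S` is a one-dimensional immersed (`C¹`) manifold in the plane: the image of an injective
immersion of a Hausdorff, second countable one-dimensional `C¹` manifold without boundary. -/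
def IsImmersedCurve (S : Set (ℝ × ℝ)) : Prop :=
  ∃ (M : Type) (_ : TopologicalSpace M) (_ : T2Space M) (_ : SecondCountableTopology M)
    (_ : ChartedSpace ℝ M) (_ : IsManifold 𝓘(ℝ, ℝ) 1 M) (ι : M → ℝ × ℝ),
    IsImmersionOnto M ι S

/-- As `IsImmersedCurve`, with the abstract manifold itself connected. -/
def IsConnectedImmersedCurve (S : Set (ℝ × ℝ)) : Prop :=
  ∃ (M : Type) (_ : TopologicalSpace M) (_ : T2Space M) (_ : SecondCountableTopology M)
    (_ : ConnectedSpace M)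
    (_ : ChartedSpace ℝ M) (_ : IsManifold 𝓘(ℝ, ℝ) 1 M) (ι : M → ℝ × ℝ),
    IsImmersionOnto M ι S

/-- The connected component of the origin in the unstable set at time `τ`. -/
def unstableManifold (n : ℕ) (h : ℝ → ℝ) (f : ℝ → ℝ → ℝ) (l τ : ℝ) : Set (ℝ × ℝ) :=
  connectedComponentIn (unstableSet n h f l τ) 0

/-- The connected component of the origin in the stable set at time `τ`. -/
def stableManifold (n : ℕ) (h : ℝ → ℝ) (f : ℝ → ℝ → ℝ) (l τ : ℝ) : Set (ℝ × ℝ) :=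
  connectedComponentIn (stableSet n h f l τ) 0

end

end Fowler

/-! The proof is a global Lyapunov–Perron argument. It needs no flow on the plane, so finite-time
blow-up is harmless.

In the time variable `s ≥ 0` running from `τ` towards the limit (`t = τ + ε s`, `ε = ±1`), the
frozen linear system is a saddle, since the exponent condition says exactly that `α_l` lies between
the two critical values (`abs_alphaL_sub_lt`). In eigencoordinates the first unknown is `x = ξ + ζ`,
with `ξ' = -λ ξ - ρ(s, x)` and `ζ' = μ ζ + ρ(s, x)`. By variation of constants, decaying solutions
correspond to the `x` in the Banach space `C₀([0, ∞))` with `x - K N(x) ∈ ℝ e`, where `N` is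
superposition by `ρ`, `K` is `perron` and `e = e^{-λ s}` (`image_initialData`). Here `N` is `C¹` on
all of `C₀`.

This solution set is a `C¹` curve in `C₀`, even far from the origin. Modifying `K` by a rank-one
operator with range in `ℝ e` does not change the set, and amounts to prescribing the decaying
component at a time `T` instead of `0` (`perronFrom`). Along a decaying `x` the coefficient `ρ'(s,
x(s))` tends to `0`, so for `T` large the linearization `1 - K_T N'(x)` is invertible in a weighted
norm (`exists_isUnit_one_sub_perronFrom`). The inverse function theorem then straightens the set to
a line.

Taking initial data is a `C¹` map to the plane. Uniqueness for the nonlinear and for the linearized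
equation makes it injective and immersive on the curve, so the whole stable or unstable set is an
immersed curve. Finally, its component of the origin pulls back to a union of components of the
parameter manifold, which is open by local connectedness; the single component through the origin
gives the connected immersed curve. -/

namespace Fowler

open scoped NNReal ZeroAtInfty

/-! ### Curves in a Banach space cut out by straightening maps -/

section LineCharts

variable {E : Type} [NormedAddCommGroup E] [NormedSpace ℝ E]

/-- The inverse function theorem, with a `C¹` inverse on the whole target. -/
theorem exists_openPartialHomeomorph_of_contDiff [CompleteSpace E] {F : E → E}
    (hF : ContDiff ℝ 1 F) {x : E} {A : E ≃L[ℝ] E} (hA : HasFDerivAt F (A : E →L[ℝ] E) x) :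
    ∃ Φ : OpenPartialHomeomorph E E, x ∈ Φ.source ∧ (∀ y, Φ y = F y) ∧
      ContDiffOn ℝ 1 Φ.symm Φ.target := by
  set Ψ := hF.contDiffAt.toOpenPartialHomeomorph F hA one_ne_zero with hΨ
  have hΨF : ∀ y, Ψ y = F y := fun y => rfl
  -- Restricting to the open set where the derivative is invertible makes the inverse `C¹` on the
  -- whole target, not only near `F x`.
  have hopen : IsOpen {y | IsUnit (fderiv ℝ F y)} :=
    Units.isOpen.preimage (hF.continuous_fderiv one_ne_zero)
  refine ⟨Ψ.restrOpen _ hopen, ?_, fun y => rfl, ?_⟩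
  · rw [OpenPartialHomeomorph.restrOpen_source]
    refine ⟨hF.contDiffAt.mem_toOpenPartialHomeomorph_source hA one_ne_zero, ?_⟩
    rw [mem_ofPred_eq, hA.fderiv]
    exact ⟨ContinuousLinearEquiv.toUnit A, rfl⟩
  · intro z hz
    have hz' := (Ψ.restrOpen _ hopen).map_target hz
    rw [OpenPartialHomeomorph.restrOpen_source] at hz'
    obtain ⟨u, hu⟩ : IsUnit (fderiv ℝ F ((Ψ.restrOpen _ hopen).symm z)) := hz'.2
    refine ((Ψ.restrOpen _ hopen).contDiffAt_symm (f₀' := ContinuousLinearEquiv.ofUnit u) hz ?_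
      hF.contDiffAt).contDiffWithinAt
    have : ((ContinuousLinearEquiv.ofUnit u : E ≃L[ℝ] E) : E →L[ℝ] E) = (u : E →L[ℝ] E) := rfl
    rw [this, hu]
    exact (hF.differentiable one_ne_zero _).hasFDerivAt

/-- If `Φ` straightens `S` to the line spanned by `e`, then `S` is parametrized by a real
coordinate on the source of `Φ`. -/
noncomputable def lineChart (S : Set E) (e : E) (ψ : E →L[ℝ] ℝ) (hψ : ψ e = 1) (x₀ : S)
    (Φ : OpenPartialHomeomorph E E) (hS : ∀ y ∈ Φ.source, y ∈ S ↔ ∃ a : ℝ, Φ y = a • e) :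
    OpenPartialHomeomorph S ℝ where
  toFun y := ψ (Φ y)
  invFun a := open Classical in
    -- Off the target the value `x₀` is only a filler.
    if h : a • e ∈ Φ.target then
      ⟨Φ.symm (a • e), (hS _ (Φ.map_target h)).2 ⟨a, Φ.right_inv h⟩⟩ else x₀
  source := {y | (y : E) ∈ Φ.source}
  target := {a | a • e ∈ Φ.target}
  map_source' := by
    rintro ⟨y, hy⟩ hys
    obtain ⟨a, ha⟩ := (hS y hys).1 hy
    have : Φ y ∈ Φ.target := Φ.map_source hys
    simpa [ha, hψ] using this
  map_target' := by
    intro a ha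
    have ha' : a • e ∈ Φ.target := ha
    simp only [ha', dif_pos, mem_ofPred_eq]
    exact Φ.map_target ha'
  left_inv' := by
    rintro ⟨y, hy⟩ hys
    obtain ⟨a, ha⟩ := (hS y hys).1 hy
    have h1 : Φ y ∈ Φ.target := Φ.map_source hys
    have h2 : ψ (Φ y) • e = Φ y := by simp [ha, hψ]
    apply Subtype.ext
    simp only [h2, h1, dif_pos]
    exact Φ.left_inv hys
  right_inv' := by
    intro a ha
    have ha' : a • e ∈ Φ.target := ha
    simp [ha', Φ.right_inv ha', hψ]
  open_source := Φ.open_source.preimage continuous_subtype_val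
  open_target := Φ.open_target.preimage (by fun_prop)
  continuousOn_toFun :=
    ψ.continuous.comp_continuousOn
      (Φ.continuousOn.comp continuous_subtype_val.continuousOn fun _ h => h)
  continuousOn_invFun := by
    rw [Topology.IsInducing.subtypeVal.continuousOn_iff]
    have h1 : ContinuousOn (fun a : ℝ => Φ.symm (a • e)) {a | a • e ∈ Φ.target} :=
      Φ.symm.continuousOn.comp (by fun_prop) fun _ h => h
    refine h1.congr fun a ha => ?_
    have ha' : a • e ∈ Φ.target := ha
    simp [ha']

theorem lineChart_symm_coe {S : Set E} {e : E} {ψ : E →L[ℝ] ℝ} {hψ : ψ e = 1} {x₀ : S}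
    {Φ : OpenPartialHomeomorph E E} {hS : ∀ y ∈ Φ.source, y ∈ S ↔ ∃ a : ℝ, Φ y = a • e}
    {a : ℝ} (ha : a • e ∈ Φ.target) :
    (((lineChart S e ψ hψ x₀ Φ hS).symm a : S) : E) = Φ.symm (a • e) := by
  change (((lineChart S e ψ hψ x₀ Φ hS).invFun a : S) : E) = _
  simp [lineChart, ha]

theorem contDiffOn_lineChart_symm {S : Set E} {e : E} {ψ : E →L[ℝ] ℝ} {hψ : ψ e = 1} {x₀ : S}
    {Φ : OpenPartialHomeomorph E E} {hS : ∀ y ∈ Φ.source, y ∈ S ↔ ∃ a : ℝ, Φ y = a • e}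
    (hΦ : ContDiffOn ℝ 1 Φ.symm Φ.target) :
    ContDiffOn ℝ 1 (fun a => (((lineChart S e ψ hψ x₀ Φ hS).symm a : S) : E))
      (lineChart S e ψ hψ x₀ Φ hS).target := by
  have h1 : ContDiffOn ℝ 1 (fun a : ℝ => Φ.symm (a • e)) {a | a • e ∈ Φ.target} :=
    hΦ.comp (by fun_prop) fun _ h => h
  exact h1.congr fun a ha => lineChart_symm_coe ha

/-- A subset of a Banach space that is locally straightened to a line by `C¹` maps is a
`C¹` curve, and `C¹` maps to the plane that are injective on it and immersive along it have
immersed curves as images. -/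
theorem isImmersedCurve_image_of_straightening [CompleteSpace E] [SecondCountableTopology E]
    {S : Set E} {e : E} (he : e ≠ 0) {Θ : E → ℝ × ℝ} (hΘ : ContDiff ℝ 1 Θ) (hinj : InjOn Θ S)
    (hloc : ∀ x ∈ S, ∃ (F : E → E) (A : E ≃L[ℝ] E), ContDiff ℝ 1 F ∧
      (∀ y, y ∈ S ↔ ∃ a : ℝ, F y = a • e) ∧ HasFDerivAt F (A : E →L[ℝ] E) x ∧
      fderiv ℝ Θ x (A.symm e) ≠ 0) :
    IsImmersedCurve (Θ '' S) := by
  obtain ⟨ψ₀, -, hψ₀⟩ := exists_dual_vector ℝ e (norm_ne_zero_iff.2 he)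
  set ψ : E →L[ℝ] ℝ := (‖e‖⁻¹ : ℝ) • ψ₀ with hψdef
  have hψ : ψ e = 1 := by
    simp [hψdef, hψ₀, he]
  choose F A hF hFS hFA hv using fun x : S => hloc x x.2
  choose Φ hxΦ hΦF hΦs using fun x : S =>
    exists_openPartialHomeomorph_of_contDiff (hF x) (hFA x)
  have hS : ∀ x : S, ∀ y ∈ (Φ x).source, y ∈ S ↔ ∃ a : ℝ, Φ x y = a • e := by
    intro x y _
    rw [hΦF x y]
    exact hFS x y
  let ch : S → OpenPartialHomeomorph S ℝ := fun x => lineChart S e ψ hψ x (Φ x) (hS x)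
  let cs : ChartedSpace ℝ S :=
    { atlas := range ch
      chartAt := ch
      mem_chart_source := hxΦ
      chart_mem_atlas := fun x => ⟨x, rfl⟩ }
  have hsymm : ∀ x : S, ContDiffOn ℝ 1 (fun a => (((ch x).symm a : S) : E)) (ch x).target :=
    fun x => contDiffOn_lineChart_symm (hΦs x)
  have : IsManifold 𝓘(ℝ, ℝ) 1 S := by
    apply isManifold_of_contDiffOn
    rintro _ _ ⟨x, rfl⟩ ⟨x', rfl⟩
    -- A transition map is an inverse chart into `E` followed by `ψ ∘ F x'`, which is `C¹` on all of
    -- `E`.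
    have hx' : ContDiff ℝ 1 (fun y : E => ψ (F x' y)) := ψ.contDiff.comp (hF x')
    have h1 := hx'.comp_contDiffOn (hsymm x)
    have h2 : ContDiffOn ℝ 1 (fun a => ψ (F x' (((ch x).symm a : S) : E)))
        ((ch x).symm ≫ₕ ch x').source := by
      refine h1.mono ?_
      rw [OpenPartialHomeomorph.trans_source]
      exact fun a ha => ha.1
    refine ContDiffOn.congr (h2.mono ?_) ?_
    · intro a ha
      simpa using ha.1
    · intro a _
      change ψ (Φ x' _) = ψ (F x' _)
      rw [hΦF]
      rfl
  have hcont : Continuous (fun p : S => Θ p) := hΘ.continuous.comp continuous_subtype_val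
  have hmd : ContMDiff 𝓘(ℝ, ℝ) 𝓘(ℝ, ℝ × ℝ) 1 (fun p : S => Θ p) := by
    intro p
    rw [contMDiffAt_iff]
    refine ⟨hcont.continuousAt, ?_⟩
    have h1 : ContDiffOn ℝ 1 (fun a => Θ (((ch p).symm a : S) : E)) (ch p).target :=
      hΘ.comp_contDiffOn (hsymm p)
    have h2 := h1.contDiffAt ((ch p).open_target.mem_nhds ((ch p).map_source (hxΦ p)))
    simp only [mfld_simps]
    exact h2.contDiffWithinAt
  refine ⟨S, inferInstance, inferInstance, inferInstance, cs, inferInstance,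
    fun p => Θ p, hmd, fun p q hpq => Subtype.ext (hinj p.2 q.2 hpq), ?_, by
      rw [image_eq_range]⟩
  intro p
  have hmem : (ch p) p ∈ (ch p).target := (ch p).map_source (hxΦ p)
  have hmem' : (ch p p) • e ∈ (Φ p).target := hmem
  have hpe : (ch p p) • e = Φ p p := by
    obtain ⟨a, ha⟩ := (hS p p (hxΦ p)).1 p.2
    change ψ (Φ p p) • e = _
    simp [ha, hψ]
  have hback : (Φ p).symm ((ch p p) • e) = p := by rw [hpe]; exact (Φ p).left_inv (hxΦ p)
  -- In its chart the curve is `a ↦ Φ⁻¹(a e)`, with velocity `A⁻¹ e`; so the image curve has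
  -- velocity `dΘ(A⁻¹ e)`, nonzero by assumption.
  have hd1 : HasFDerivAt (Φ p).symm ((A p).symm : E →L[ℝ] E) ((ch p p) • e) := by
    apply (Φ p).hasFDerivAt_symm hmem'
    rw [hback]
    have : ((Φ p : OpenPartialHomeomorph E E) : E → E) = F p := funext (hΦF p)
    rw [this]
    exact hFA p
  have hd2 : HasDerivAt (fun a : ℝ => a • e) e (ch p p) := by
    simpa using (hasDerivAt_id (ch p p)).smul_const e
  have hd3 : HasDerivAt (fun a : ℝ => (Φ p).symm (a • e)) ((A p).symm e) (ch p p) :=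
    HasFDerivAt.comp_hasDerivAt (f := fun a : ℝ => a • e) _ hd1 hd2
  have hd4 : HasDerivAt (fun a : ℝ => Θ ((Φ p).symm (a • e))) (fderiv ℝ Θ p ((A p).symm e))
      (ch p p) := by
    have : HasFDerivAt Θ (fderiv ℝ Θ p) ((Φ p).symm (ch p p • e)) := by
      rw [hback]; exact (hΘ.differentiable one_ne_zero _).hasFDerivAt
    exact HasFDerivAt.comp_hasDerivAt (f := fun a : ℝ => (Φ p).symm (a • e)) _ this hd3
  have hd5 : HasDerivAt (fun a : ℝ => Θ (((ch p).symm a : S) : E))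
      (fderiv ℝ Θ p ((A p).symm e)) (ch p p) := by
    refine hd4.congr_of_eventuallyEq ?_
    filter_upwards [(ch p).open_target.mem_nhds hmem] with a ha
    rw [lineChart_symm_coe ha]
  have hmf : mfderiv 𝓘(ℝ, ℝ) 𝓘(ℝ, ℝ × ℝ) (fun p : S => Θ p) p
      = fderiv ℝ (fun a : ℝ => Θ (((ch p).symm a : S) : E)) (ch p p) := by
    rw [MDifferentiableAt.mfderiv (hmd.mdifferentiable one_ne_zero p)]
    simp only [mfld_simps, fderivWithin_univ]
    rfl
  rw [hmf, hd5.hasFDerivAt.fderiv]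
  intro s t hst
  change ℝ at s t
  have hst' : s • fderiv ℝ Θ p ((A p).symm e) = t • fderiv ℝ Θ p ((A p).symm e) := by
    exact hst
  exact smul_left_injective ℝ (hv p) hst'

end LineCharts

/-! ### Open pieces, linear images and components of immersed curves -/

section Components

variable {M : Type} [TopologicalSpace M] [ChartedSpace ℝ M] {ι : M → ℝ × ℝ} {S : Set (ℝ × ℝ)}

/-- Near a point the inverse chart of the open submanifold agrees with that of `M`, so both maps
have the same derivative. -/
theorem IsImmersionOnto.restrict_opens [IsManifold 𝓘(ℝ, ℝ) 1 M] (hι : IsImmersionOnto M ι S)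
    (U : TopologicalSpace.Opens M) :
    IsImmersionOnto U (fun p : U => ι p) (ι '' U) := by
  obtain ⟨hd, hinj, hmf, -⟩ := hι
  have hd' : ContMDiff 𝓘(ℝ, ℝ) 𝓘(ℝ, ℝ × ℝ) 1 (fun p : U => ι p) :=
    hd.comp contMDiff_subtype_val
  refine ⟨hd', fun p q hpq => Subtype.ext (hinj hpq), ?_, by rw [image_eq_range]; rfl⟩
  intro p
  have key : mfderiv 𝓘(ℝ, ℝ) 𝓘(ℝ, ℝ × ℝ) (fun p : U => ι p) p
      = mfderiv 𝓘(ℝ, ℝ) 𝓘(ℝ, ℝ × ℝ) ι p := by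
    rw [MDifferentiableAt.mfderiv (hd'.mdifferentiable one_ne_zero p),
      MDifferentiableAt.mfderiv (hd.mdifferentiable one_ne_zero (p : M))]
    simp only [mfld_simps, fderivWithin_univ]
    refine Filter.EventuallyEq.fderiv_eq ?_
    have h := U.chartAt_subtype_val_symm_eventuallyEq (H := ℝ) (x := p)
    filter_upwards [h] with a ha
    simp only [Function.comp_apply] at ha ⊢
    rw [ha]
  rw [key]
  exact hmf p

theorem IsImmersionOnto.comp_continuousLinearEquiv (hι : IsImmersionOnto M ι S)
    (P : (ℝ × ℝ) ≃L[ℝ] (ℝ × ℝ)) : IsImmersionOnto M (fun p => P (ι p)) (P '' S) := by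
  obtain ⟨hd, hinj, hmf, hr⟩ := hι
  have hP : ContMDiff 𝓘(ℝ, ℝ × ℝ) 𝓘(ℝ, ℝ × ℝ) 1 P := P.contDiff.contMDiff
  refine ⟨hP.comp hd, P.injective.comp hinj, fun p => ?_, ?_⟩
  · have : mfderiv 𝓘(ℝ, ℝ) 𝓘(ℝ, ℝ × ℝ) (fun p => P (ι p)) p
        = (P : (ℝ × ℝ) →L[ℝ] (ℝ × ℝ)).comp (mfderiv 𝓘(ℝ, ℝ) 𝓘(ℝ, ℝ × ℝ) ι p) := by
      have h := mfderiv_comp (I := 𝓘(ℝ, ℝ)) (I' := 𝓘(ℝ, ℝ × ℝ)) (I'' := 𝓘(ℝ, ℝ × ℝ)) p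
        (hP.mdifferentiable one_ne_zero (ι p)) (hd.mdifferentiable one_ne_zero p)
      rw [mfderiv_eq_fderiv, P.fderiv] at h
      exact h
    rw [this]
    exact P.injective.comp (hmf p)
  · rw [← hr, ← range_comp]
    rfl

theorem IsImmersedCurve.image_continuousLinearEquiv (hS : IsImmersedCurve S)
    (P : (ℝ × ℝ) ≃L[ℝ] (ℝ × ℝ)) : IsImmersedCurve (P '' S) := by
  obtain ⟨M, i1, i2, i3, i4, i5, ι, hι⟩ := hS
  exact ⟨M, i1, i2, i3, i4, i5, _, hι.comp_continuousLinearEquiv P⟩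

/-- The connected component of a point of an immersed curve is an immersed curve, and contains
one with a connected parameter manifold. -/
theorem IsImmersedCurve.connectedComponentIn (hS : IsImmersedCurve S) {x : ℝ × ℝ} (hx : x ∈ S) :
    IsImmersedCurve (connectedComponentIn S x) ∧
      ∃ W ⊆ connectedComponentIn S x, x ∈ W ∧ IsConnectedImmersedCurve W := by
  obtain ⟨M, i1, i2, i3, i4, i5, ι, hι⟩ := hS
  have hcont : Continuous ι := hι.1.continuous
  have hr : range ι = S := hι.2.2.2
  have : LocallyConnectedSpace M := ChartedSpace.locallyConnectedSpace ℝ M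
  have hsub : ∀ p : M, ι p ∈ _root_.connectedComponentIn S x →
      ι '' connectedComponent p ⊆ _root_.connectedComponentIn S x := by
    intro p hp
    rw [connectedComponentIn_eq hp]
    refine (isPreconnected_connectedComponent.image _ hcont.continuousOn).subset_connectedComponentIn
      ⟨p, mem_connectedComponent, rfl⟩ ?_
    rw [← hr]
    exact image_subset_range _ _
  constructor
  -- The component of `S` in the plane may pull back to many components of `M`; with each point it
  -- contains that point's whole component, which is open.
  · let U : TopologicalSpace.Opens M :=
      { carrier := ι ⁻¹' _root_.connectedComponentIn S x
        is_open' := by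
          rw [isOpen_iff_mem_nhds]
          intro p hp
          refine mem_of_superset (isOpen_connectedComponent.mem_nhds mem_connectedComponent) ?_
          exact image_subset_iff.1 (hsub p hp) }
    have hU : ι '' (U : Set M) = _root_.connectedComponentIn S x := by
      change ι '' (ι ⁻¹' _) = _
      rw [image_preimage_eq_inter_range, hr]
      exact inter_eq_left.2 (connectedComponentIn_subset S x)
    rw [← hU]
    exact ⟨U, inferInstance, inferInstance, inferInstance, inferInstance, inferInstance, _,
      hι.restrict_opens U⟩
  · obtain ⟨p, rfl⟩ : x ∈ range ι := by rwa [hr]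
    let U : TopologicalSpace.Opens M :=
      { carrier := connectedComponent p
        is_open' := isOpen_connectedComponent }
    have : ConnectedSpace U := isConnected_iff_connectedSpace.1 isConnected_connectedComponent
    exact ⟨ι '' U, hsub p (mem_connectedComponentIn hx), ⟨p, mem_connectedComponent, rfl⟩,
      U, inferInstance, inferInstance, inferInstance, inferInstance, inferInstance, inferInstance,
      _, hι.restrict_opens U⟩

end Components

/-! ### The Banach space of functions on the half-line vanishing at infinity -/

section ZeroAtInfty

theorem abs_apply_le_norm (q : C₀(ℝ≥0, ℝ)) (t : ℝ≥0) : |q t| ≤ ‖q‖ := by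
  rw [← Real.norm_eq_abs, ← ZeroAtInftyContinuousMap.norm_toBCF_eq_norm]
  exact q.toBCF.norm_coe_le_norm t

theorem norm_le_of_forall_abs_le {q : C₀(ℝ≥0, ℝ)} {c : ℝ} (hc : 0 ≤ c) (h : ∀ t, |q t| ≤ c) :
    ‖q‖ ≤ c := by
  rw [← ZeroAtInftyContinuousMap.norm_toBCF_eq_norm]
  exact (BoundedContinuousFunction.norm_le hc).2 h

theorem tendsto_atTop_zero (q : C₀(ℝ≥0, ℝ)) : Tendsto q atTop (𝓝 0) := by
  have := q.zero_at_infty'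
  rwa [cocompact_eq_atTop] at this

/-- Functions on the half-line that vanish at infinity, as functions on the compact space
`[0, ∞]`. -/
noncomputable def toENNRealMap (q : C₀(ℝ≥0, ℝ)) : C(ENNReal, ℝ) where
  toFun t := if t = ⊤ then 0 else q t.toNNReal
  continuous_toFun := by
    rw [continuous_iff_continuousAt]
    intro t
    by_cases ht : t = ⊤
    · subst ht
      rw [Metric.continuousAt_iff']
      intro ε hε
      have h1 : ∀ᶠ s in atTop, |q s| < ε := by
        have := (tendsto_atTop_zero q).eventually (Metric.ball_mem_nhds 0 hε)
        simpa using this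
      obtain ⟨R, hR⟩ := eventually_atTop.1 h1
      filter_upwards [Ioi_mem_nhds (ENNReal.coe_lt_top : (R : ENNReal) < ⊤)] with s hs
      by_cases hs' : s = ⊤
      · simp [hs', hε]
      · simp only [hs', if_false, if_true, dist_zero_right, Real.norm_eq_abs]
        exact hR _ (by
          rw [← ENNReal.coe_le_coe, ENNReal.coe_toNNReal hs']; exact hs.le)
    · have h1 : ContinuousAt (fun t : ENNReal => q t.toNNReal) t :=
        (map_continuous q).continuousAt.comp
          (ENNReal.continuousOn_toNNReal.continuousAt (isOpen_ne.mem_nhds ht))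
      refine h1.congr ?_
      filter_upwards [isOpen_ne.mem_nhds ht] with s hs
      simp [show s ≠ ⊤ from hs]

theorem isometry_toENNRealMap : Isometry toENNRealMap := by
  refine Isometry.of_dist_eq fun p q => le_antisymm ?_ ?_
  · rw [ContinuousMap.dist_le dist_nonneg]
    intro t
    by_cases ht : t = ⊤
    · simp [toENNRealMap, ht]
    · simp only [toENNRealMap, ContinuousMap.coe_mk, ht, if_false]
      rw [dist_eq_norm p q, Real.dist_eq]
      exact abs_apply_le_norm (p - q) _
  · rw [dist_eq_norm p q]
    refine norm_le_of_forall_abs_le dist_nonneg fun t => ?_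
    have := ContinuousMap.dist_apply_le_dist (f := toENNRealMap p) (g := toENNRealMap q)
      (t : ENNReal)
    simpa [toENNRealMap, Real.dist_eq] using this

/-- The space embeds isometrically in continuous functions on the compact metrizable space `[0, ∞]`.
The solution curve inherits from it the second countability demanded of a manifold. -/
instance secondCountableTopology_zeroAtInfty : SecondCountableTopology C₀(ℝ≥0, ℝ) :=
  isometry_toENNRealMap.isUniformInducing.isInducing.secondCountableTopology

/-- Evaluation at a time, as a continuous functional. -/
noncomputable def evalAt (t : ℝ≥0) : C₀(ℝ≥0, ℝ) →L[ℝ] ℝ :=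
  LinearMap.mkContinuous
    { toFun := fun q => q t
      map_add' := fun _ _ => rfl
      map_smul' := fun _ _ => rfl } 1 fun q => by
    simpa using abs_apply_le_norm q t

@[simp] theorem evalAt_apply (t : ℝ≥0) (q : C₀(ℝ≥0, ℝ)) : evalAt t q = q t := rfl

/-- The extension of a function on the half-line to the real line, constant on `(-∞, 0]`. -/
noncomputable def extend (q : C₀(ℝ≥0, ℝ)) (s : ℝ) : ℝ := q s.toNNReal

@[fun_prop]
theorem continuous_extend (q : C₀(ℝ≥0, ℝ)) : Continuous (extend q) :=
  (map_continuous q).comp continuous_real_toNNReal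

theorem abs_extend_le (q : C₀(ℝ≥0, ℝ)) (s : ℝ) : |extend q s| ≤ ‖q‖ := abs_apply_le_norm _ _

theorem tendsto_extend (q : C₀(ℝ≥0, ℝ)) : Tendsto (extend q) atTop (𝓝 0) :=
  (tendsto_atTop_zero q).comp tendsto_real_toNNReal_atTop

@[simp] theorem extend_coe (q : C₀(ℝ≥0, ℝ)) (t : ℝ≥0) : extend q t = q t := by simp [extend]

theorem extend_add (p q : C₀(ℝ≥0, ℝ)) (s : ℝ) : extend (p + q) s = extend p s + extend q s := rfl

theorem extend_smul (c : ℝ) (q : C₀(ℝ≥0, ℝ)) (s : ℝ) : extend (c • q) s = c * extend q s := rfl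

/-- A function on the line, continuous on `[0, ∞)` and with limit `0` at infinity. -/
noncomputable def ofTendsto (u : ℝ → ℝ) (hu : ContinuousOn u (Ici 0))
    (hlim : Tendsto u atTop (𝓝 0)) : C₀(ℝ≥0, ℝ) where
  toFun t := u t
  continuous_toFun := hu.comp_continuous NNReal.continuous_coe fun t => t.2
  zero_at_infty' := by
    rw [cocompact_eq_atTop]
    exact hlim.comp (NNReal.tendsto_coe_atTop.2 tendsto_id)

@[simp] theorem ofTendsto_apply {u : ℝ → ℝ} (hu : ContinuousOn u (Ici 0))
    (hlim : Tendsto u atTop (𝓝 0)) (t : ℝ≥0) : ofTendsto u hu hlim t = u t := rfl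

end ZeroAtInfty

/-! ### Forward and backward Duhamel integrals and the Lyapunov–Perron operator -/

section Kernels

theorem abs_integral_le_of_abs_le_exp {φ : ℝ → ℝ} {m κ a b : ℝ} (hκ : κ ≠ 0) (hab : a ≤ b)
    (h : ∀ s ∈ Icc a b, |φ s| ≤ m * Real.exp (κ * s)) :
    |∫ s in a..b, φ s| ≤ m * (Real.exp (κ * b) - Real.exp (κ * a)) / κ := by
  have hint : ∫ s in a..b, m * Real.exp (κ * s)
      = m * (Real.exp (κ * b) - Real.exp (κ * a)) / κ := by
    have hd : ∀ s ∈ uIcc a b, HasDerivAt (fun s => m * Real.exp (κ * s) / κ)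
        (m * Real.exp (κ * s)) s := by
      intro s _
      have := ((((hasDerivAt_id s).const_mul κ).exp).const_mul m).div_const κ
      convert! this using 1
      simp only [id]
      field_simp
    rw [intervalIntegral.integral_eq_sub_of_hasDerivAt hd
      (Continuous.intervalIntegrable (by fun_prop) _ _)]
    ring
  rw [← hint, ← Real.norm_eq_abs]
  refine intervalIntegral.norm_integral_le_of_norm_le hab ?_
    (Continuous.intervalIntegrable (by fun_prop) _ _)
  exact Eventually.of_forall fun s hs => h s ⟨hs.1.le, hs.2⟩

theorem integrableOn_exp_mul_extend {μ : ℝ} (hμ : 0 < μ) (q : C₀(ℝ≥0, ℝ)) (t : ℝ) :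
    IntegrableOn (fun s => Real.exp (-μ * s) * extend q s) (Ioi t) := by
  refine Integrable.mono' ((integrableOn_exp_mul_Ioi (neg_lt_zero.2 hμ) t).mul_const ‖q‖)
    (Continuous.aestronglyMeasurable (by fun_prop)) (Eventually.of_forall fun s => ?_)
  rw [norm_mul, Real.norm_eq_abs, Real.norm_eq_abs, abs_of_pos (Real.exp_pos _)]
  exact mul_le_mul_of_nonneg_left (abs_extend_le q s) (Real.exp_pos _).le

/-- The solution of `u' = -λ u + q` with `u(0) = 0`. -/
noncomputable def decayPart (lam : ℝ) (q : C₀(ℝ≥0, ℝ)) (t : ℝ) : ℝ :=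
  Real.exp (-lam * t) * ∫ s in (0 : ℝ)..t, Real.exp (lam * s) * extend q s

/-- The bounded solution of `u' = μ u - q`. -/
noncomputable def growPart (μ : ℝ) (q : C₀(ℝ≥0, ℝ)) (t : ℝ) : ℝ :=
  Real.exp (μ * t) * ∫ s in Ioi t, Real.exp (-μ * s) * extend q s

theorem hasDerivAt_decayPart (lam : ℝ) (q : C₀(ℝ≥0, ℝ)) (t : ℝ) :
    HasDerivAt (decayPart lam q) (-lam * decayPart lam q t + extend q t) t := by
  have hc : Continuous fun s => Real.exp (lam * s) * extend q s := by fun_prop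
  have h1 := intervalIntegral.integral_hasDerivAt_right (hc.intervalIntegrable 0 t)
    hc.aestronglyMeasurable.stronglyMeasurableAtFilter hc.continuousAt
  have h2 : HasDerivAt (fun t : ℝ => Real.exp (-lam * t)) (Real.exp (-lam * t) * (-lam * 1)) t :=
    ((hasDerivAt_id t).const_mul (-lam)).exp
  have h3 := h2.mul h1
  have h4 : Real.exp (-lam * t) * Real.exp (lam * t) = 1 := by
    rw [← Real.exp_add]; simp
  convert! h3 using 1
  rw [decayPart, ← mul_assoc (Real.exp (-lam * t)) (Real.exp (lam * t)), h4]
  ring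

/-- Moving the base point to a fixed `a` leaves an interval integral, which can be differentiated in
`t`, or split at `a`. -/
theorem growPart_eq {μ : ℝ} (hμ : 0 < μ) (q : C₀(ℝ≥0, ℝ)) (a t : ℝ) :
    growPart μ q t = Real.exp (μ * t) * ((∫ s in Ioi a, Real.exp (-μ * s) * extend q s)
      - ∫ s in a..t, Real.exp (-μ * s) * extend q s) := by
  have hc : Continuous fun s => Real.exp (-μ * s) * extend q s := by fun_prop
  rw [growPart, ← intervalIntegral.integral_interval_add_Ioi
    (integrableOn_exp_mul_extend hμ q a) (integrableOn_exp_mul_extend hμ q t)]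
  ring

theorem hasDerivAt_growPart {μ : ℝ} (hμ : 0 < μ) (q : C₀(ℝ≥0, ℝ)) (t : ℝ) :
    HasDerivAt (growPart μ q) (μ * growPart μ q t - extend q t) t := by
  have hc : Continuous fun s => Real.exp (-μ * s) * extend q s := by fun_prop
  have h1 := intervalIntegral.integral_hasDerivAt_right (hc.intervalIntegrable 0 t)
    hc.aestronglyMeasurable.stronglyMeasurableAtFilter hc.continuousAt
  have h2 : HasDerivAt (fun t : ℝ => Real.exp (μ * t)) (Real.exp (μ * t) * (μ * 1)) t :=
    ((hasDerivAt_id t).const_mul μ).exp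
  have h3 := h2.mul (h1.const_sub (∫ s in Ioi (0 : ℝ), Real.exp (-μ * s) * extend q s))
  have h4 : Real.exp (μ * t) * Real.exp (-μ * t) = 1 := by
    rw [← Real.exp_add]; simp
  have h5 : growPart μ q = fun t => Real.exp (μ * t) *
      ((∫ s in Ioi (0 : ℝ), Real.exp (-μ * s) * extend q s)
      - ∫ s in (0 : ℝ)..t, Real.exp (-μ * s) * extend q s) := funext (growPart_eq hμ q 0)
  rw [h5]
  convert! h3 using 1
  rw [mul_neg, ← mul_assoc (Real.exp (μ * t)) (Real.exp (-μ * t)), h4]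
  ring

/-- Only values of `q` after `t` enter, so this one bound gives both boundedness of the operator and
decay at infinity. -/
theorem abs_growPart_le {μ : ℝ} (hμ : 0 < μ) {q : C₀(ℝ≥0, ℝ)} {t m : ℝ}
    (h : ∀ s, t < s → |extend q s| ≤ m) : |growPart μ q t| ≤ m / μ := by
  have h1 : ‖∫ s in Ioi t, Real.exp (-μ * s) * extend q s‖
      ≤ ∫ s in Ioi t, Real.exp (-μ * s) * m := by
    refine norm_integral_le_of_norm_le
      ((integrableOn_exp_mul_Ioi (neg_lt_zero.2 hμ) t).mul_const m) ?_
    filter_upwards [ae_restrict_mem measurableSet_Ioi] with s hs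
    rw [norm_mul, Real.norm_eq_abs, Real.norm_eq_abs, abs_of_pos (Real.exp_pos _)]
    exact mul_le_mul_of_nonneg_left (h s hs) (Real.exp_pos _).le
  rw [integral_mul_const, integral_exp_mul_Ioi (neg_lt_zero.2 hμ), Real.norm_eq_abs] at h1
  rw [growPart, abs_mul, abs_of_pos (Real.exp_pos _)]
  calc Real.exp (μ * t) * _ ≤ Real.exp (μ * t) * _ :=
        mul_le_mul_of_nonneg_left h1 (Real.exp_pos _).le
    _ = (Real.exp (μ * t) * Real.exp (-μ * t)) * m / μ := by field_simp
    _ = m / μ := by rw [← Real.exp_add]; simp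

theorem abs_exp_mul_integral_le {lam : ℝ} (hlam : 0 < lam) {q : C₀(ℝ≥0, ℝ)} {a t m : ℝ}
    (hm : 0 ≤ m) (hat : a ≤ t) (h : ∀ s ∈ Icc a t, |extend q s| ≤ m) :
    |Real.exp (-lam * t) * ∫ s in a..t, Real.exp (lam * s) * extend q s| ≤ m / lam := by
  have h1 := abs_integral_le_of_abs_le_exp (φ := fun s => Real.exp (lam * s) * extend q s)
    (m := m) hlam.ne' hat (fun s hs => by
      rw [abs_mul, abs_of_pos (Real.exp_pos _), mul_comm]
      exact mul_le_mul_of_nonneg_right (h s hs) (Real.exp_pos _).le)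
  rw [abs_mul, abs_of_pos (Real.exp_pos _)]
  calc Real.exp (-lam * t) * _ ≤ Real.exp (-lam * t) * (m * Real.exp (lam * t) / lam) := by
        refine mul_le_mul_of_nonneg_left (h1.trans ?_) (Real.exp_pos _).le
        gcongr
        linarith [Real.exp_pos (lam * a)]
    _ = (Real.exp (-lam * t) * Real.exp (lam * t)) * m / lam := by ring
    _ = m / lam := by rw [← Real.exp_add]; simp

theorem tendsto_growPart {μ : ℝ} (hμ : 0 < μ) (q : C₀(ℝ≥0, ℝ)) :
    Tendsto (growPart μ q) atTop (𝓝 0) := by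
  rw [Metric.tendsto_atTop]
  intro ε hε
  obtain ⟨T, hT⟩ := Metric.tendsto_atTop.1 (tendsto_extend q) (ε * μ / 2) (by positivity)
  refine ⟨T, fun t ht => ?_⟩
  rw [dist_zero_right, Real.norm_eq_abs]
  have := abs_growPart_le hμ (q := q) (t := t) (m := ε * μ / 2) fun s hs => by
    have := hT s (ht.trans hs.le)
    rw [dist_zero_right, Real.norm_eq_abs] at this
    exact this.le
  have h2 : ε * μ / 2 / μ = ε / 2 := by field_simp
  linarith

theorem tendsto_exp_neg_mul {lam : ℝ} (hlam : 0 < lam) :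
    Tendsto (fun t : ℝ => Real.exp (-lam * t)) atTop (𝓝 0) := by
  refine Real.tendsto_exp_atBot.comp ?_
  exact tendsto_id.const_mul_atTop_of_neg (neg_lt_zero.2 hlam)

theorem tendsto_decayPart {lam : ℝ} (hlam : 0 < lam) (q : C₀(ℝ≥0, ℝ)) :
    Tendsto (decayPart lam q) atTop (𝓝 0) := by
  have hc : Continuous fun s => Real.exp (lam * s) * extend q s := by fun_prop
  rw [Metric.tendsto_atTop]
  intro ε hε
  obtain ⟨T, hT⟩ := Metric.tendsto_atTop.1 (tendsto_extend q) (ε * lam / 2) (by positivity)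
  have h1 : Tendsto (fun t : ℝ => Real.exp (-lam * t) *
      ∫ s in (0 : ℝ)..T, Real.exp (lam * s) * extend q s) atTop (𝓝 0) := by
    simpa using (tendsto_exp_neg_mul hlam).mul_const
      (∫ s in (0 : ℝ)..T, Real.exp (lam * s) * extend q s)
  obtain ⟨T', hT'⟩ := Metric.tendsto_atTop.1 h1 (ε / 2) (by positivity)
  refine ⟨max T T', fun t ht => ?_⟩
  have h2 := hT' t ((le_max_right _ _).trans ht)
  have hTt : T ≤ t := (le_max_left _ _).trans ht
  have h3 := abs_exp_mul_integral_le hlam (q := q) (a := T) (t := t) (m := ε * lam / 2)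
    (by positivity) hTt fun s hs => by
      have := hT s hs.1
      rw [dist_zero_right, Real.norm_eq_abs] at this
      exact this.le
  have h4 : ε * lam / 2 / lam = ε / 2 := by field_simp
  rw [dist_zero_right, Real.norm_eq_abs] at h2 ⊢
  -- The contribution of `[0, T]` is a constant times `e^{-λ t}`; that of `[T, t]` is small because
  -- `q` is small there.
  rw [decayPart, ← intervalIntegral.integral_add_adjacent_intervals (hc.intervalIntegrable 0 T)
    (hc.intervalIntegrable T t), mul_add]
  refine (abs_add_le _ _).trans_lt ?_
  linarith

theorem integral_exp_mul_extend_add (κ : ℝ) (p q : C₀(ℝ≥0, ℝ)) (a b : ℝ) :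
    ∫ s in a..b, Real.exp (κ * s) * extend (p + q) s
      = (∫ s in a..b, Real.exp (κ * s) * extend p s)
        + ∫ s in a..b, Real.exp (κ * s) * extend q s := by
  rw [← intervalIntegral.integral_add (Continuous.intervalIntegrable (by fun_prop) _ _)
    (Continuous.intervalIntegrable (by fun_prop) _ _)]
  simp [extend_add, mul_add]

theorem integral_exp_mul_extend_smul (κ c : ℝ) (q : C₀(ℝ≥0, ℝ)) (a b : ℝ) :
    ∫ s in a..b, Real.exp (κ * s) * extend (c • q) s
      = c * ∫ s in a..b, Real.exp (κ * s) * extend q s := by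
  rw [← intervalIntegral.integral_const_mul]
  congr 1
  ext s
  rw [extend_smul]
  ring

theorem growPart_add {μ : ℝ} (hμ : 0 < μ) (p q : C₀(ℝ≥0, ℝ)) (t : ℝ) :
    growPart μ (p + q) t = growPart μ p t + growPart μ q t := by
  simp only [growPart, ← mul_add]
  rw [← integral_add (integrableOn_exp_mul_extend hμ p t) (integrableOn_exp_mul_extend hμ q t)]
  simp [extend_add, mul_add]

theorem growPart_smul (μ c : ℝ) (q : C₀(ℝ≥0, ℝ)) (t : ℝ) :
    growPart μ (c • q) t = c * growPart μ q t := by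
  have : ∀ s, Real.exp (-μ * s) * extend (c • q) s
      = c * (Real.exp (-μ * s) * extend q s) := fun s => by
    rw [extend_smul]; ring
  simp only [growPart, this]
  rw [integral_const_mul]
  ring

/-- The linear Lyapunov--Perron operator: `K q = ξ + ζ` where `ξ' = -λ ξ - q`, `ξ(0) = 0` and
`ζ' = μ ζ + q` with `ζ` bounded. -/
noncomputable def perron {lam μ : ℝ} (hlam : 0 < lam) (hμ : 0 < μ) :
    C₀(ℝ≥0, ℝ) →L[ℝ] C₀(ℝ≥0, ℝ) :=
  LinearMap.mkContinuous
    { toFun := fun q => ofTendsto (fun t => -decayPart lam q t - growPart μ q t)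
        (fun t _ => ((hasDerivAt_decayPart lam q t).neg.sub
          (hasDerivAt_growPart hμ q t)).continuousAt.continuousWithinAt)
        (by simpa using (tendsto_decayPart hlam q).neg.sub (tendsto_growPart hμ q))
      map_add' := fun p q => by
        ext t
        simp only [ofTendsto_apply, ZeroAtInftyContinuousMap.add_apply, decayPart,
          integral_exp_mul_extend_add, growPart_add hμ]
        ring
      map_smul' := fun c q => by
        ext t
        simp only [ofTendsto_apply, ZeroAtInftyContinuousMap.smul_apply, decayPart,
          integral_exp_mul_extend_smul, growPart_smul, RingHom.id_apply, smul_eq_mul]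
        ring } (1 / lam + 1 / μ) fun q => by
    refine norm_le_of_forall_abs_le (by positivity) fun t => ?_
    have h1 := abs_exp_mul_integral_le hlam (q := q) (norm_nonneg q) t.2
      fun s _ => abs_extend_le q s
    have h2 := abs_growPart_le hμ (q := q) (t := t) fun s _ => abs_extend_le q s
    have h3 := abs_sub (-decayPart lam q t) (growPart μ q t)
    rw [abs_neg] at h3
    have h4 : (1 / lam + 1 / μ) * ‖q‖ = ‖q‖ / lam + ‖q‖ / μ := by ring
    rw [h4]
    exact h3.trans (add_le_add h1 h2)

theorem perron_apply {lam μ : ℝ} (hlam : 0 < lam) (hμ : 0 < μ) (q : C₀(ℝ≥0, ℝ)) (t : ℝ≥0) :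
    perron hlam hμ q t = -decayPart lam q t - growPart μ q t := rfl

theorem perron_apply_zero {lam μ : ℝ} (hlam : 0 < lam) (hμ : 0 < μ) (q : C₀(ℝ≥0, ℝ)) :
    perron hlam hμ q 0 = -growPart μ q 0 := by
  simp [perron_apply, decayPart]

/-- The decaying exponential `t ↦ e^{-λ t}`. -/
noncomputable def expDecay {lam : ℝ} (hlam : 0 < lam) : C₀(ℝ≥0, ℝ) :=
  ofTendsto (fun t => Real.exp (-lam * t)) (by fun_prop) (tendsto_exp_neg_mul hlam)

theorem expDecay_apply {lam : ℝ} (hlam : 0 < lam) (t : ℝ≥0) :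
    expDecay hlam t = Real.exp (-lam * t) := rfl

theorem expDecay_ne_zero {lam : ℝ} (hlam : 0 < lam) : expDecay hlam ≠ 0 := by
  intro h
  have := congrArg (fun q : C₀(ℝ≥0, ℝ) => q 0) h
  simp [expDecay_apply] at this

/-- The functional `q ↦ ∫₀ᵀ e^{λ s} q(s) ds`. -/
noncomputable def expMoment {lam : ℝ} (hlam : 0 < lam) (T : ℝ≥0) : C₀(ℝ≥0, ℝ) →L[ℝ] ℝ :=
  LinearMap.mkContinuous
    { toFun := fun q => ∫ s in (0 : ℝ)..T, Real.exp (lam * s) * extend q s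
      map_add' := fun p q => integral_exp_mul_extend_add lam p q 0 T
      map_smul' := fun c q => integral_exp_mul_extend_smul lam c q 0 T }
    (Real.exp (lam * T) / lam) fun q => by
    have h1 := abs_integral_le_of_abs_le_exp (φ := fun s => Real.exp (lam * s) * extend q s)
      (m := ‖q‖) hlam.ne' T.2 (fun s _ => by
        rw [abs_mul, abs_of_pos (Real.exp_pos _), mul_comm]
        exact mul_le_mul_of_nonneg_right (abs_extend_le q s) (Real.exp_pos _).le)
    refine h1.trans ?_
    rw [mul_comm (Real.exp _ / _), ← mul_div_assoc]
    have : (0 : ℝ) ≤ Real.exp (lam * 0) := (Real.exp_pos _).le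
    gcongr
    exact sub_le_self _ this

theorem expMoment_apply {lam : ℝ} (hlam : 0 < lam) (T : ℝ≥0) (q : C₀(ℝ≥0, ℝ)) :
    expMoment hlam T q = ∫ s in (0 : ℝ)..T, Real.exp (lam * s) * extend q s := rfl

/-- The Lyapunov--Perron operator whose decaying component vanishes at time `T`. -/
noncomputable def perronFrom {lam μ : ℝ} (hlam : 0 < lam) (hμ : 0 < μ) (T : ℝ≥0) :
    C₀(ℝ≥0, ℝ) →L[ℝ] C₀(ℝ≥0, ℝ) :=
  perron hlam hμ + (expMoment hlam T).smulRight (expDecay hlam)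

theorem perronFrom_eq {lam μ : ℝ} (hlam : 0 < lam) (hμ : 0 < μ) (T : ℝ≥0) (q : C₀(ℝ≥0, ℝ)) :
    perronFrom hlam hμ T q = perron hlam hμ q + expMoment hlam T q • expDecay hlam := rfl

/-- The rank-one correction moves the lower limit of the forward integral from `0` to `T`. -/
theorem perronFrom_apply {lam μ : ℝ} (hlam : 0 < lam) (hμ : 0 < μ) (T : ℝ≥0) (q : C₀(ℝ≥0, ℝ))
    (t : ℝ≥0) :
    perronFrom hlam hμ T q t =
      -(Real.exp (-lam * t) * ∫ s in (T : ℝ)..t, Real.exp (lam * s) * extend q s)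
        - growPart μ q t := by
  have hc : Continuous fun s => Real.exp (lam * s) * extend q s := by fun_prop
  rw [perronFrom_eq, ZeroAtInftyContinuousMap.add_apply, ZeroAtInftyContinuousMap.smul_apply,
    perron_apply, expDecay_apply, expMoment_apply, decayPart,
    ← intervalIntegral.integral_add_adjacent_intervals (hc.intervalIntegrable 0 T)
      (hc.intervalIntegrable T t), smul_eq_mul]
  ring

end Kernels

/-! ### Smoothness of the superposition operator -/

section Superposition

/-- A nonlinearity `ρ(t, x)` on `t ≥ 0`, vanishing at `x = 0`, with `x`-derivative `ρ'` that is
locally bounded and locally uniformly continuous in `x`, uniformly in `t`, and that is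
asymptotically of higher order at `x = 0`. -/
structure IsTame (ρ ρ' : ℝ≥0 → ℝ → ℝ) : Prop where
  continuous : Continuous fun p : ℝ≥0 × ℝ => ρ p.1 p.2
  hasDerivAt : ∀ t x, HasDerivAt (ρ t) (ρ' t x) x
  zero : ∀ t, ρ t 0 = 0
  tendsto_zero : Tendsto (fun t => ρ' t 0) atTop (𝓝 0)
  bound : ∀ R : ℝ, ∃ C, ∀ t x, |x| ≤ R → |ρ' t x| ≤ C
  unif : ∀ R : ℝ, ∀ ε > 0, ∃ δ > 0, ∀ t x y, |x| ≤ R → |y| ≤ R → |x - y| < δ →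
    |ρ' t x - ρ' t y| < ε

variable {ρ ρ' : ℝ≥0 → ℝ → ℝ}

theorem IsTame.abs_sub_le (h : IsTame ρ ρ') {R C : ℝ} (hC : ∀ t x, |x| ≤ R → |ρ' t x| ≤ C)
    (t : ℝ≥0) {x y : ℝ} (hx : |x| ≤ R) (hy : |y| ≤ R) : |ρ t x - ρ t y| ≤ C * |x - y| := by
  have := (convex_Icc (-R) R).norm_image_sub_le_of_norm_hasDerivWithin_le (f := ρ t) (f' := ρ' t)
    (C := C) (x := y) (y := x) (fun z _ => (h.hasDerivAt t z).hasDerivWithinAt)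
    (fun z hz => hC t z (abs_le.2 hz)) (abs_le.1 hy) (abs_le.1 hx)
  simpa using this

/-- Joint continuity of `ρ'` is not part of the definition. Difference quotients of `ρ` with a fixed
step are jointly continuous, and the mean value theorem with the modulus in `unif` puts them within
`ε` of `ρ'`, locally uniformly. -/
theorem IsTame.continuous_deriv (h : IsTame ρ ρ') :
    Continuous fun p : ℝ≥0 × ℝ => ρ' p.1 p.2 := by
  rw [continuous_iff_continuousAt]
  rintro ⟨t₀, x₀⟩
  refine continuousAt_of_locally_uniform_approx_of_continuousAt fun u hu => ?_
  obtain ⟨ε, hε, hεu⟩ := Metric.mem_uniformity_dist.1 hu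
  obtain ⟨δ, hδ, H⟩ := h.unif (|x₀| + 2) ε hε
  -- A step below `δ` serves the modulus; a step below `1` keeps the intermediate point within
  -- radius `|x₀| + 2`.
  set s := min δ 1 / 2 with hs
  have hs0 : 0 < s := by positivity
  have hsδ : s < δ := by
    have := min_le_left δ 1; linarith
  have hs1 : s < 1 := by
    have := min_le_right δ 1; linarith
  have hnhds : {p : ℝ≥0 × ℝ | |p.2 - x₀| < 1} ∈ 𝓝 (t₀, x₀) := by
    refine IsOpen.mem_nhds (isOpen_lt (by fun_prop) (by fun_prop)) ?_
    simp
  refine ⟨_, hnhds, fun p => (ρ p.1 (p.2 + s) - ρ p.1 p.2) / s, ?_, ?_⟩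
  · have h1 : Continuous fun p : ℝ≥0 × ℝ => ρ p.1 (p.2 + s) :=
      h.continuous.comp (f := fun p : ℝ≥0 × ℝ => (p.1, p.2 + s)) (by fun_prop)
    exact ((h1.sub h.continuous).div_const s).continuousAt
  · rintro ⟨t, x⟩ hx
    replace hx : |x - x₀| < 1 := hx
    apply hεu
    obtain ⟨c, hc, hc'⟩ := exists_hasDerivAt_eq_slope (ρ t) (ρ' t) (show x < x + s by linarith)
      (fun y _ => (h.hasDerivAt t y).continuousAt.continuousWithinAt)
      (fun y _ => h.hasDerivAt t y)
    have e1 : (x + s - x) = s := by ring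
    rw [e1] at hc'
    simp only
    rw [← hc', Real.dist_eq]
    have hx1 := abs_lt.1 hx
    have hx2 := neg_abs_le x₀
    have hx3 := le_abs_self x₀
    refine H t x c (abs_le.2 ⟨by linarith, by linarith⟩)
      (abs_le.2 ⟨by linarith [hc.1], by linarith [hc.2]⟩) ?_
    rw [abs_sub_comm, abs_of_pos (by linarith [hc.1])]
    linarith [hc.2]

/-- The superposition operator `x ↦ ρ(·, x(·))`. -/
noncomputable def IsTame.superpose (h : IsTame ρ ρ') (x : C₀(ℝ≥0, ℝ)) : C₀(ℝ≥0, ℝ) where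
  toFun t := ρ t (x t)
  continuous_toFun := h.continuous.comp (f := fun t => (t, x t)) (by fun_prop)
  zero_at_infty' := by
    obtain ⟨C, hC⟩ := h.bound ‖x‖
    have h1 : Tendsto (fun t => C * |x t|) (cocompact ℝ≥0) (𝓝 0) := by
      simpa using x.zero_at_infty'.abs.const_mul C
    refine squeeze_zero_norm (fun t => ?_) h1
    have := h.abs_sub_le hC t (abs_apply_le_norm x t) (y := 0) (by simp)
    simpa [h.zero] using this

@[simp] theorem IsTame.superpose_apply (h : IsTame ρ ρ') (x : C₀(ℝ≥0, ℝ)) (t : ℝ≥0) :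
    h.superpose x t = ρ t (x t) := rfl

/-- The linearization of the superposition operator along `x`. -/
noncomputable def IsTame.superposeDeriv (h : IsTame ρ ρ') (x : C₀(ℝ≥0, ℝ)) : C₀(ℝ≥0, ℝ) where
  toFun t := ρ' t (x t)
  continuous_toFun := h.continuous_deriv.comp (f := fun t => (t, x t)) (by fun_prop)
  zero_at_infty' := by
    rw [cocompact_eq_atTop]
    have h1 : Tendsto (fun t => ρ' t (x t) - ρ' t 0) atTop (𝓝 0) := by
      rw [Metric.tendsto_nhds]
      intro ε hε
      obtain ⟨δ, hδ, H⟩ := h.unif ‖x‖ ε hε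
      filter_upwards [(tendsto_atTop_zero x).eventually (Metric.ball_mem_nhds 0 hδ)] with t ht
      rw [dist_zero_right]
      refine H t (x t) 0 (abs_apply_le_norm x t) (by simp) ?_
      simpa using ht
    simpa using h1.add h.tendsto_zero

@[simp] theorem IsTame.superposeDeriv_apply (h : IsTame ρ ρ') (x : C₀(ℝ≥0, ℝ)) (t : ℝ≥0) :
    h.superposeDeriv x t = ρ' t (x t) := rfl

theorem IsTame.continuous_superposeDeriv (h : IsTame ρ ρ') : Continuous h.superposeDeriv := by
  rw [Metric.continuous_iff]
  intro x ε hε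
  obtain ⟨δ, hδ, H⟩ := h.unif (‖x‖ + 1) (ε / 2) (by positivity)
  refine ⟨min δ 1, by positivity, fun y hy => ?_⟩
  rw [dist_eq_norm] at hy ⊢
  refine (norm_le_of_forall_abs_le (by positivity) fun t => ?_).trans_lt (half_lt_self hε)
  have hyx : |y t - x t| < min δ 1 := (abs_apply_le_norm (y - x) t).trans_lt hy
  have hxt := abs_apply_le_norm x t
  refine (H t (y t) (x t) ?_ (by linarith) (hyx.trans_le (min_le_left _ _))).le
  have h1 := abs_sub_abs_le_abs_sub (y t) (x t)
  have h2 := min_le_right δ 1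
  linarith

/-- The modulus of continuity of `ρ'` is uniform in time, so the pointwise mean value remainder is
at most `ε ‖v‖` at every time, hence in the sup norm. -/
theorem IsTame.hasFDerivAt_superpose (h : IsTame ρ ρ') (x : C₀(ℝ≥0, ℝ)) :
    HasFDerivAt h.superpose (ContinuousLinearMap.mul ℝ C₀(ℝ≥0, ℝ) (h.superposeDeriv x)) x := by
  rw [hasFDerivAt_iff_isLittleO_nhds_zero, Asymptotics.isLittleO_iff]
  intro ε hε
  obtain ⟨δ, hδ, H⟩ := h.unif (‖x‖ + 1) ε hε
  filter_upwards [Metric.ball_mem_nhds (0 : C₀(ℝ≥0, ℝ)) (show 0 < min δ 1 by positivity)] with v hv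
  rw [mem_ball_zero_iff] at hv
  refine norm_le_of_forall_abs_le (by positivity) fun t => ?_
  have hvt := abs_apply_le_norm v t
  have hxt := abs_apply_le_norm x t
  have hv1 := min_le_right δ 1
  have hvδ := min_le_left δ 1
  have key := (convex_uIcc (x t) (x t + v t)).norm_image_sub_le_of_norm_hasDerivWithin_le
    (f := fun y => ρ t y - ρ' t (x t) * y) (f' := fun y => ρ' t y - ρ' t (x t))
    (C := ε) (x := x t) (y := x t + v t)
    (fun z _ => by
      have := (h.hasDerivAt t z).sub ((hasDerivAt_id z).const_mul (ρ' t (x t)))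
      rw [mul_one] at this
      exact this.hasDerivWithinAt)
    (fun z hz => by
      have hz1 : |z - x t| ≤ |v t| := by
        have := abs_sub_left_of_mem_uIcc hz
        simpa using this
      have h1 := abs_sub_abs_le_abs_sub z (x t)
      exact (H t z (x t) (by linarith) (by linarith) (by linarith)).le)
    left_mem_uIcc right_mem_uIcc
  have e1 : (h.superpose (x + v) - h.superpose x
      - (ContinuousLinearMap.mul ℝ C₀(ℝ≥0, ℝ) (h.superposeDeriv x)) v) t
      = ρ t (x t + v t) - ρ' t (x t) * (x t + v t) - (ρ t (x t) - ρ' t (x t) * x t) := by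
    simp
    ring
  rw [e1]
  refine key.trans ?_
  rw [add_sub_cancel_left]
  exact mul_le_mul_of_nonneg_left hvt hε.le

theorem IsTame.contDiff_superpose (h : IsTame ρ ρ') : ContDiff ℝ 1 h.superpose :=
  contDiff_one_iff_hasFDerivAt.2
    ⟨fun x => ContinuousLinearMap.mul ℝ C₀(ℝ≥0, ℝ) (h.superposeDeriv x),
      (ContinuousLinearMap.continuous _).comp h.continuous_superposeDeriv,
      h.hasFDerivAt_superpose⟩

end Superposition

/-! ### Invertibility of the linearized equation in a weighted norm -/

section Invertibility

/-- Multiplication by a bounded continuous function. -/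
noncomputable def mulBounded {b : ℝ≥0 → ℝ} (hb : Continuous b) {C : ℝ} (hC : ∀ t, |b t| ≤ C) :
    C₀(ℝ≥0, ℝ) →L[ℝ] C₀(ℝ≥0, ℝ) :=
  LinearMap.mkContinuous
    { toFun := fun q =>
        { toFun := fun t => b t * q t
          continuous_toFun := hb.mul (map_continuous q)
          zero_at_infty' := by
            have h1 : Tendsto (fun t => C * |q t|) (cocompact ℝ≥0) (𝓝 0) := by
              simpa using q.zero_at_infty'.abs.const_mul C
            refine squeeze_zero_norm (fun t => ?_) h1
            rw [norm_mul, Real.norm_eq_abs, Real.norm_eq_abs]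
            exact mul_le_mul_of_nonneg_right (hC t) (abs_nonneg _) }
      map_add' := fun p q => by ext t; exact mul_add _ _ _
      map_smul' := fun c q => by ext t; exact mul_left_comm _ _ _ } C fun q => by
    have hC0 : 0 ≤ C := (abs_nonneg _).trans (hC 0)
    refine norm_le_of_forall_abs_le (by positivity) fun t => ?_
    change |b t * q t| ≤ _
    rw [abs_mul]
    exact mul_le_mul (hC t) (abs_apply_le_norm q t) (abs_nonneg _) hC0

/-- Both integrals for `t ≤ T` run over `[t, T]`, apart from the tail of the growing part after `T`.
The weight `e^{-θ (T - t)}` turns the former into quantities of order `1/θ`; after `T` only the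
small bound `ε` is felt. -/
theorem abs_exp_mul_perronFrom_le {lam μ : ℝ} (hlam : 0 < lam) (hμ : 0 < μ) (T : ℝ≥0)
    {q : C₀(ℝ≥0, ℝ)} {θ C ε : ℝ} (hθ : lam < θ) (hC : 0 ≤ C) (hε : 0 ≤ ε)
    (h1 : ∀ s : ℝ, 0 ≤ s → s ≤ T → |extend q s| ≤ C * Real.exp (θ * (T - s)))
    (h2 : ∀ s : ℝ, (T : ℝ) ≤ s → |extend q s| ≤ ε) (t : ℝ≥0) :
    Real.exp (-θ * max ((T : ℝ) - t) 0) * |perronFrom hlam hμ T q t|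
      ≤ C / (θ - lam) + C / (θ + μ) + ε / lam + ε / μ := by
  have hθl : 0 < θ - lam := by linarith
  have hθμ : 0 < θ + μ := by linarith
  have n1 : 0 ≤ C / (θ - lam) := by positivity
  have n2 : 0 ≤ C / (θ + μ) := by positivity
  have n3 : 0 ≤ ε / lam := by positivity
  rw [perronFrom_apply]
  rcases le_total (T : ℝ) t with hTt | htT
  · rw [max_eq_right (by linarith), mul_zero, Real.exp_zero, one_mul]
    have b1 := abs_exp_mul_integral_le hlam (q := q) hε hTt fun s hs => h2 s hs.1
    have b2 := abs_growPart_le hμ (q := q) (t := t) fun s hs => h2 s (hTt.trans hs.le)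
    refine (abs_sub _ _).trans ?_
    rw [abs_neg]
    linarith
  · rw [max_eq_left (by linarith)]
    have ht0 : (0 : ℝ) ≤ t := t.2
    have bound : ∀ κ : ℝ, κ < θ →
        |∫ s in (t : ℝ)..T, Real.exp (κ * s) * extend q s|
          ≤ C * Real.exp (θ * T) * Real.exp ((κ - θ) * t) / (θ - κ) := by
      intro κ hκ
      have hκ' : κ - θ < 0 := by linarith
      refine (abs_integral_le_of_abs_le_exp (φ := fun s => Real.exp (κ * s) * extend q s)
        (m := C * Real.exp (θ * T)) hκ'.ne htT fun s hs => ?_).trans ?_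
      · rw [abs_mul, abs_of_pos (Real.exp_pos _)]
        refine (mul_le_mul_of_nonneg_left (h1 s (ht0.trans hs.1) hs.2)
          (Real.exp_pos _).le).trans_eq ?_
        rw [mul_left_comm, mul_assoc, ← Real.exp_add, ← Real.exp_add]
        ring_nf
      · rw [← neg_div_neg_eq, neg_sub, ← mul_neg, neg_sub]
        have := (Real.exp_pos ((κ - θ) * T)).le
        have : 0 ≤ θ - κ := by linarith
        gcongr
        linarith
    have b1 := bound lam hθ
    have b2 := bound (-μ) (by linarith)
    rw [sub_neg_eq_add] at b2
    have b3 := abs_growPart_le hμ (q := q) (t := T) fun s hs => h2 s hs.le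
    have e1 : growPart μ q t = Real.exp (μ * t) *
        (∫ s in (t : ℝ)..T, Real.exp (-μ * s) * extend q s)
        + Real.exp (-(μ * (T - t))) * growPart μ q T := by
      rw [growPart_eq hμ q T t, growPart, intervalIntegral.integral_symm, ← mul_assoc,
        ← Real.exp_add]
      ring_nf
    have e2 : ∫ s in (T : ℝ)..t, Real.exp (lam * s) * extend q s
        = -∫ s in (t : ℝ)..T, Real.exp (lam * s) * extend q s :=
      intervalIntegral.integral_symm _ _
    rw [e1, e2]
    set w := Real.exp (-θ * (T - t)) with hw
    set I := ∫ s in (t : ℝ)..T, Real.exp (lam * s) * extend q s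
    set J := ∫ s in (t : ℝ)..T, Real.exp (-μ * s) * extend q s
    have hw1 : w ≤ 1 := Real.exp_le_one_iff.2 (by nlinarith)
    have hw0 : 0 < w := Real.exp_pos _
    have c1 : w * (Real.exp (-lam * t) * |I|) ≤ C / (θ - lam) := by
      calc w * (Real.exp (-lam * t) * |I|) ≤ w * (Real.exp (-lam * t) *
            (C * Real.exp (θ * T) * Real.exp ((lam - θ) * t) / (θ - lam))) := by gcongr
        _ = C * (w * Real.exp (-lam * t) * Real.exp (θ * T) * Real.exp ((lam - θ) * t))
            / (θ - lam) := by ring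
        _ = C / (θ - lam) := by
            rw [hw, ← Real.exp_add, ← Real.exp_add, ← Real.exp_add]
            ring_nf
            simp
    have c2 : w * (Real.exp (μ * t) * |J|) ≤ C / (θ + μ) := by
      calc w * (Real.exp (μ * t) * |J|) ≤ w * (Real.exp (μ * t) *
            (C * Real.exp (θ * T) * Real.exp ((-μ - θ) * t) / (θ + μ))) := by gcongr
        _ = C * (w * Real.exp (μ * t) * Real.exp (θ * T) * Real.exp ((-μ - θ) * t))
            / (θ + μ) := by ring
        _ = C / (θ + μ) := by
            rw [hw, ← Real.exp_add, ← Real.exp_add, ← Real.exp_add]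
            ring_nf
            simp
    have c3 : w * (Real.exp (-(μ * (T - t))) * |growPart μ q T|) ≤ ε / μ := by
      have h3 : Real.exp (-(μ * (T - t))) ≤ 1 := Real.exp_le_one_iff.2 (by nlinarith)
      have h4 : Real.exp (-(μ * (T - t))) * |growPart μ q T| ≤ 1 * (ε / μ) := by gcongr
      have h5 : w * (Real.exp (-(μ * (T - t))) * |growPart μ q T|) ≤ 1 * (1 * (ε / μ)) := by
        gcongr
      linarith
    have tri : |-(Real.exp (-lam * t) * -I)
          - (Real.exp (μ * t) * J + Real.exp (-(μ * (T - t))) * growPart μ q T)|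
        ≤ Real.exp (-lam * t) * |I|
          + (Real.exp (μ * t) * |J| + Real.exp (-(μ * (T - t))) * |growPart μ q T|) := by
      refine (abs_sub _ _).trans (add_le_add ?_ ((abs_add_le _ _).trans (add_le_add ?_ ?_)))
      · rw [abs_neg, abs_mul, abs_neg, abs_of_pos (Real.exp_pos _)]
      · rw [abs_mul, abs_of_pos (Real.exp_pos _)]
      · rw [abs_mul, abs_of_pos (Real.exp_pos _)]
    have := mul_le_mul_of_nonneg_left tri hw0.le
    rw [mul_add, mul_add] at this
    linarith

/-- The linearized Lyapunov--Perron equation is uniquely solvable when the decaying component is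
prescribed at a late enough time. -/
theorem exists_isUnit_one_sub_perronFrom {lam μ : ℝ} (hlam : 0 < lam) (hμ : 0 < μ)
    (b : C₀(ℝ≥0, ℝ)) :
    ∃ T : ℝ≥0, IsUnit
      (1 - (perronFrom hlam hμ T).comp (ContinuousLinearMap.mul ℝ C₀(ℝ≥0, ℝ) b)) := by
  obtain ⟨ε, hε, hεs⟩ : ∃ ε > 0, ε / lam + ε / μ ≤ 1 / 2 := by
    refine ⟨1 / (2 * (1 / lam + 1 / μ)), by positivity, le_of_eq ?_⟩
    field_simp
  obtain ⟨T, hT⟩ : ∃ T : ℝ≥0, ∀ s ≥ T, |b s| ≤ ε := by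
    have := (tendsto_atTop_zero b).eventually (Metric.ball_mem_nhds 0 hε)
    obtain ⟨T, hT⟩ := eventually_atTop.1 this
    refine ⟨T, fun s hs => ?_⟩
    have := hT s hs
    simp at this
    exact this.le
  refine ⟨T, ?_⟩
  set L := (perronFrom hlam hμ T).comp (ContinuousLinearMap.mul ℝ C₀(ℝ≥0, ℝ) b)
  set C := ‖b‖
  have hC : 0 ≤ C := norm_nonneg b
  -- This makes `C / (θ - λ)` and `C / (θ + μ)` at most `1/8` each; with the tail contribution `1/2`
  -- the weighted norm is at most `3/4`.
  set θ := lam + (8 * C + 1) with hθ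
  have hθ0 : 0 < θ := by positivity
  have hw : ∀ t : ℝ≥0, |Real.exp (-θ * max ((T : ℝ) - t) 0)| ≤ 1 := by
    intro t
    rw [abs_of_pos (Real.exp_pos _), Real.exp_le_one_iff]
    have := le_max_right ((T : ℝ) - t) 0
    nlinarith
  have hw' : ∀ t : ℝ≥0, |Real.exp (θ * max ((T : ℝ) - t) 0)| ≤ Real.exp (θ * T) := by
    intro t
    rw [abs_of_pos (Real.exp_pos _), Real.exp_le_exp]
    exact mul_le_mul_of_nonneg_left (max_le (sub_le_self _ t.2) T.2) hθ0.le
  -- Conjugation by `W` plays the role of an equivalent weighted norm: the weight is bounded above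
  -- and below because it only acts on `[0, T]`.
  set W := mulBounded (b := fun t : ℝ≥0 => Real.exp (-θ * max ((T : ℝ) - t) 0))
    (by fun_prop) hw with hW
  set W' := mulBounded (b := fun t : ℝ≥0 => Real.exp (θ * max ((T : ℝ) - t) 0))
    (by fun_prop) hw' with hW'
  have hWW' : W * W' = 1 := by
    ext q t
    change Real.exp _ * (Real.exp _ * q t) = q t
    rw [← mul_assoc, ← Real.exp_add]
    simp
  have hW'W : W' * W = 1 := by
    ext q t
    change Real.exp _ * (Real.exp _ * q t) = q t
    rw [← mul_assoc, ← Real.exp_add]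
    simp
  have hnorm : ‖W * L * W'‖ ≤ 3 / 4 := by
    refine ContinuousLinearMap.opNorm_le_bound _ (by norm_num) fun v => ?_
    refine norm_le_of_forall_abs_le (by positivity) fun t => ?_
    set q : C₀(ℝ≥0, ℝ) := b * W' v with hq
    have hqs : ∀ s : ℝ≥0, |q s| = |b s| * (Real.exp (θ * max ((T : ℝ) - s) 0) * |v s|) := by
      intro s
      change |b s * (Real.exp _ * v s)| = _
      rw [abs_mul, abs_mul, abs_of_pos (Real.exp_pos _)]
    have main := abs_exp_mul_perronFrom_le hlam hμ T (q := q) (θ := θ) (C := C * ‖v‖)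
      (ε := ε * ‖v‖) (by rw [hθ]; linarith) (by positivity) (by positivity)
      (fun s hs hsT => by
        lift s to ℝ≥0 using hs
        rw [extend_coe, hqs, max_eq_left (by linarith)]
        calc |b s| * (Real.exp (θ * (T - s)) * |v s|)
            ≤ C * (Real.exp (θ * (T - s)) * ‖v‖) := by
              gcongr
              · exact abs_apply_le_norm b s
              · exact abs_apply_le_norm v s
          _ = C * ‖v‖ * Real.exp (θ * (T - s)) := by ring)
      (fun s hs => by
        lift s to ℝ≥0 using T.2.trans hs
        rw [extend_coe, hqs, max_eq_right (by linarith), mul_zero, Real.exp_zero, one_mul]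
        have := hT s (by exact_mod_cast hs)
        gcongr
        exact abs_apply_le_norm v s) t
    have e1 : ((W * L * W') v) t
        = Real.exp (-θ * max ((T : ℝ) - t) 0) * perronFrom hlam hμ T q t := rfl
    rw [e1, abs_mul, abs_of_pos (Real.exp_pos _)]
    refine main.trans ?_
    have k1 : C / (θ - lam) ≤ 1 / 8 := by
      rw [hθ, add_sub_cancel_left, div_le_div_iff₀ (by positivity) (by norm_num)]
      linarith
    have k2 : C / (θ + μ) ≤ 1 / 8 := by
      rw [hθ, div_le_div_iff₀ (by positivity) (by norm_num)]
      linarith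
    have : C * ‖v‖ / (θ - lam) + C * ‖v‖ / (θ + μ) + ε * ‖v‖ / lam + ε * ‖v‖ / μ
        = (C / (θ - lam) + C / (θ + μ) + (ε / lam + ε / μ)) * ‖v‖ := by ring
    rw [this]
    have hv := norm_nonneg v
    gcongr
    linarith
  have hunit : IsUnit (1 - W * L * W') :=
    isUnit_one_sub_of_norm_lt_one (R := C₀(ℝ≥0, ℝ) →L[ℝ] C₀(ℝ≥0, ℝ)) (hnorm.trans_lt (by norm_num))
  have e2 : 1 - L = W' * (1 - W * L * W') * W := by
    have hid : ∀ v, W' (W v) = v := fun v => DFunLike.congr_fun hW'W v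
    refine ContinuousLinearMap.ext fun v => ?_
    change v - L v = W' (W v - W (L (W' (W v))))
    rw [map_sub, hid, hid]
  rw [e2]
  have hu : IsUnit W := ⟨⟨W, W', hWW', hW'W⟩, rfl⟩
  have hu' : IsUnit W' := ⟨⟨W', W, hW'W, hWW'⟩, rfl⟩
  exact (hu'.mul hunit).mul hu

end Invertibility

/-! ### Decaying solutions of the perturbed saddle and their initial data -/

section Saddle

theorem eq_zero_of_hasDerivWithinAt_of_norm_le {V : Type*} [NormedAddCommGroup V] [NormedSpace ℝ V]
    {f f' : ℝ → V} {K : ℝ} (hf : ∀ t, 0 ≤ t → HasDerivWithinAt f (f' t) (Ici 0) t) (h0 : f 0 = 0)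
    (hK : ∀ t, 0 ≤ t → ‖f' t‖ ≤ K * ‖f t‖) {t : ℝ} (ht : 0 ≤ t) : f t = 0 :=
  eq_zero_of_abs_deriv_le_mul_abs_self_of_eq_zero_right (f' := f') (K := K) (a := 0) (b := t)
    (fun s hs => (hf s hs.1).continuousWithinAt.mono fun _ h => h.1)
    (fun s hs => (hf s hs.1).mono fun _ h => hs.1.trans h) h0 (fun s hs => hK s hs.1) t
    ⟨ht, le_rfl⟩

variable {lam μ : ℝ} {ρ ρ' : ℝ≥0 → ℝ → ℝ}

theorem zeroAtInfty_add_smul (r s : ℝ) (q : C₀(ℝ≥0, ℝ)) : (r + s) • q = r • q + s • q :=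
  add_smul r s q

theorem zeroAtInfty_sub_smul (r s : ℝ) (q : C₀(ℝ≥0, ℝ)) : (r - s) • q = r • q - s • q :=
  sub_smul r s q

theorem hasDerivAt_mul_exp (c κ t : ℝ) :
    HasDerivAt (fun t => c * Real.exp (κ * t)) (κ * (c * Real.exp (κ * t))) t := by
  have := (((hasDerivAt_id t).const_mul κ).exp).const_mul c
  convert! this using 1
  simp only [id]
  ring

theorem eq_mul_exp_of_hasDerivWithinAt {f : ℝ → ℝ} {κ : ℝ}
    (hf : ∀ t, 0 ≤ t → HasDerivWithinAt f (κ * f t) (Ici 0) t) {t : ℝ} (ht : 0 ≤ t) :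
    f t = f 0 * Real.exp (κ * t) := by
  have := eq_zero_of_hasDerivWithinAt_of_norm_le (f := fun t => f t - f 0 * Real.exp (κ * t))
    (f' := fun t => κ * (f t - f 0 * Real.exp (κ * t))) (K := |κ|)
    (fun t ht => by
      rw [mul_sub]
      exact (hf t ht).sub (hasDerivAt_mul_exp (f 0) κ t).hasDerivWithinAt)
    (by simp) (fun t _ => by rw [norm_mul, Real.norm_eq_abs κ]) ht
  exact sub_eq_zero.1 this

/-- A decaying solution of the linear equation with zero initial data and a forcing controlled by
the solution vanishes. -/
theorem eq_zero_of_eq_perron_add (hlam : 0 < lam) (hμ : 0 < μ) {u q : C₀(ℝ≥0, ℝ)} {c C : ℝ}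
    (hu : u = perron hlam hμ q + c • expDecay hlam) (hu0 : u 0 = perron hlam hμ q 0)
    (hq0 : perron hlam hμ q 0 = 0) (hC : ∀ t, |q t| ≤ C * |u t|) : u = 0 := by
  -- Evaluation at time `0`, where `e = 1`, isolates `c`.
  have hc : c = 0 := by
    have := congrArg (fun p : C₀(ℝ≥0, ℝ) => p 0) hu
    simp only [hu0, ZeroAtInftyContinuousMap.add_apply, ZeroAtInftyContinuousMap.smul_apply,
      expDecay_apply] at this
    simpa using this
  subst hc
  have hC0 : ∀ t, |q t| ≤ max C 0 * |u t| := fun t =>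
    (hC t).trans (mul_le_mul_of_nonneg_right (le_max_left _ _) (abs_nonneg _))
  set D := max C 0
  have hD : 0 ≤ D := le_max_right _ _
  rw [zero_smul, add_zero] at hu
  have hut : ∀ t : ℝ≥0, u t = -decayPart lam q t - growPart μ q t := by
    intro t
    rw [hu, perron_apply]
  -- Both components vanish at `0` and their derivatives are bounded linearly by the pair itself,
  -- since `u` is minus their sum: Grönwall applies.
  have key : ∀ t : ℝ, 0 ≤ t → (decayPart lam q t, growPart μ q t) = (0 : ℝ × ℝ) := by
    intro t ht
    refine eq_zero_of_hasDerivWithinAt_of_norm_le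
      (f := fun t => (decayPart lam q t, growPart μ q t))
      (f' := fun t => (-lam * decayPart lam q t + extend q t, μ * growPart μ q t - extend q t))
      (K := lam + μ + 2 * D)
      (fun t _ => ((hasDerivAt_decayPart lam q t).prodMk
        (hasDerivAt_growPart hμ q t)).hasDerivWithinAt) ?_ ?_ ht
    · rw [perron_apply_zero] at hq0
      rw [Prod.mk_eq_zero]
      exact ⟨by simp [decayPart], by simpa using hq0⟩
    · intro t ht
      lift t to ℝ≥0 using ht
      have hq := hC0 t
      rw [hut] at hq
      set a := decayPart lam q t
      set b := growPart μ q t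
      rw [extend_coe]
      have ha : |a| ≤ max |a| |b| := le_max_left _ _
      have hb : |b| ≤ max |a| |b| := le_max_right _ _
      rw [Prod.norm_def, Prod.norm_def]
      simp only [Real.norm_eq_abs]
      set m := max |a| |b|
      have hm : 0 ≤ m := (abs_nonneg a).trans ha
      have h1 : |-a - b| ≤ 2 * m := by
        refine (abs_sub _ _).trans ?_
        rw [abs_neg]
        linarith
      have h2 : |q t| ≤ D * (2 * m) := hq.trans (mul_le_mul_of_nonneg_left h1 hD)
      refine max_le ((abs_add_le _ _).trans ?_) ((abs_sub _ _).trans ?_)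
      · rw [abs_mul, abs_neg, abs_of_pos hlam]
        nlinarith
      · rw [abs_mul, abs_of_pos hμ]
        nlinarith
  ext t
  have := key t t.2
  rw [Prod.mk_eq_zero] at this
  rw [hut, this.1, this.2]
  simp

/-- Initial data of the solutions of `ξ' = -λ ξ - ρ(t, ξ + ζ)`, `ζ' = μ ζ + ρ(t, ξ + ζ)` on
`[0, ∞)` that tend to the origin. -/
def decayingData (lam μ : ℝ) (ρ : ℝ≥0 → ℝ → ℝ) : Set (ℝ × ℝ) :=
  {P | ∃ ξ ζ : ℝ → ℝ,
    (∀ t, 0 ≤ t → HasDerivWithinAt ξ (-lam * ξ t - ρ t.toNNReal (ξ t + ζ t)) (Ici 0) t) ∧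
    (∀ t, 0 ≤ t → HasDerivWithinAt ζ (μ * ζ t + ρ t.toNNReal (ξ t + ζ t)) (Ici 0) t) ∧
    Tendsto ξ atTop (𝓝 0) ∧ Tendsto ζ atTop (𝓝 0) ∧ P = (ξ 0, ζ 0)}

/-- The decaying solutions, as functions `x = ξ + ζ`. -/
def decayingSolutions (hlam : 0 < lam) (hμ : 0 < μ) (h : IsTame ρ ρ') : Set C₀(ℝ≥0, ℝ) :=
  {x | ∃ a : ℝ, x = perron hlam hμ (h.superpose x) + a • expDecay hlam}

/-- The initial data `(ξ(0), ζ(0))` of a decaying solution. -/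
noncomputable def initialData (hlam : 0 < lam) (hμ : 0 < μ) (h : IsTame ρ ρ')
    (x : C₀(ℝ≥0, ℝ)) : ℝ × ℝ :=
  (evalAt 0 x - evalAt 0 (perron hlam hμ (h.superpose x)),
    evalAt 0 (perron hlam hμ (h.superpose x)))

/-- Variation of constants: the decaying component has a free homogeneous term, while decay leaves
none in the growing component. -/
theorem image_initialData (hlam : 0 < lam) (hμ : 0 < μ) (h : IsTame ρ ρ') :
    initialData hlam hμ h '' decayingSolutions hlam hμ h = decayingData lam μ ρ := by
  apply Subset.antisymm
  · rintro _ ⟨x, ⟨a, ha⟩, rfl⟩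
    set q := h.superpose x with hq
    have hx : ∀ t : ℝ, 0 ≤ t → extend q t = ρ t.toNNReal
        (-decayPart lam q t + a * Real.exp (-lam * t) + -growPart μ q t) := by
      intro t ht
      lift t to ℝ≥0 using ht
      rw [extend_coe, Real.toNNReal_coe, hq, h.superpose_apply, ← hq]
      congr 1
      conv_lhs => rw [ha]
      rw [ZeroAtInftyContinuousMap.add_apply, ZeroAtInftyContinuousMap.smul_apply, perron_apply,
        expDecay_apply, smul_eq_mul]
      ring
    refine ⟨fun t => -decayPart lam q t + a * Real.exp (-lam * t), fun t => -growPart μ q t,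
      fun t ht => ?_, fun t ht => ?_, ?_, ?_, ?_⟩
    · simp only
      rw [← hx t ht]
      convert! ((hasDerivAt_decayPart lam q t).neg.add
        (hasDerivAt_mul_exp a (-lam) t)).hasDerivWithinAt using 1
      ring
    · simp only
      rw [← hx t ht]
      convert! (hasDerivAt_growPart hμ q t).neg.hasDerivWithinAt using 1
      ring
    · simpa using (tendsto_decayPart hlam q).neg.add ((tendsto_exp_neg_mul hlam).const_mul a)
    · simpa using (tendsto_growPart hμ q).neg
    · have e1 : x 0 = perron hlam hμ q 0 + a := by
        conv_lhs => rw [ha]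
        simp [expDecay_apply]
      rw [perron_apply_zero] at e1
      simp [initialData, ← hq, perron_apply_zero, decayPart, e1]
  · rintro _ ⟨ξ, ζ, hξ, hζ, hξ0, hζ0, rfl⟩
    set x : C₀(ℝ≥0, ℝ) := ofTendsto (fun t => ξ t + ζ t)
      (fun t ht => ((hξ t (mem_Ici.1 ht)).add (hζ t (mem_Ici.1 ht))).continuousWithinAt) (by simpa using hξ0.add hζ0)
    have hxt : ∀ t : ℝ≥0, x t = ξ t + ζ t := fun _ => rfl
    clear_value x
    set q := h.superpose x with hq
    have hqt : ∀ t : ℝ, 0 ≤ t → extend q t = ρ t.toNNReal (ξ t + ζ t) := by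
      intro t ht
      lift t to ℝ≥0 using ht
      rw [extend_coe, Real.toNNReal_coe, hq, h.superpose_apply, hxt]
    have h1 : ∀ t : ℝ, 0 ≤ t → ξ t = -decayPart lam q t + ξ 0 * Real.exp (-lam * t) := by
      intro t ht
      have := eq_mul_exp_of_hasDerivWithinAt (f := fun t => ξ t + decayPart lam q t) (κ := -lam)
        (fun t ht => by
          convert! (hξ t ht).add (hasDerivAt_decayPart lam q t).hasDerivWithinAt using 1
          rw [hqt t ht]
          ring) ht
      simp only [decayPart, mul_zero, intervalIntegral.integral_same, add_zero] at this
      rw [decayPart]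
      linarith
    have h2 : ∀ t : ℝ, 0 ≤ t →
        ζ t + growPart μ q t = (ζ 0 + growPart μ q 0) * Real.exp (μ * t) := by
      intro t ht
      exact eq_mul_exp_of_hasDerivWithinAt (f := fun t => ζ t + growPart μ q t) (κ := μ)
        (fun t ht => by
          convert! (hζ t ht).add (hasDerivAt_growPart hμ q t).hasDerivWithinAt using 1
          rw [hqt t ht]
          ring) ht
    -- A multiple of `e^{μ t}` that tends to `0` must be zero.
    have h3 : ζ 0 + growPart μ q 0 = 0 := by
      have hlim : Tendsto (fun t => |ζ t + growPart μ q t|) atTop (𝓝 0) := by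
        simpa using (hζ0.add (tendsto_growPart hμ q)).abs
      refine abs_eq_zero.1 (le_antisymm (ge_of_tendsto hlim ?_) (abs_nonneg _))
      filter_upwards [eventually_ge_atTop 0] with t ht
      rw [h2 t ht, abs_mul, abs_of_pos (Real.exp_pos _)]
      exact le_mul_of_one_le_right (abs_nonneg _) (Real.one_le_exp (by positivity))
    refine ⟨x, ⟨ξ 0, ?_⟩, ?_⟩
    · ext t
      have h4 := h2 t t.2
      rw [h3, zero_mul] at h4
      rw [ZeroAtInftyContinuousMap.add_apply, ZeroAtInftyContinuousMap.smul_apply, perron_apply,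
        expDecay_apply, smul_eq_mul, hxt, h1 t t.2]
      linarith
    · have h5 : perron hlam hμ q 0 = ζ 0 := by
        rw [perron_apply_zero]
        linarith
      have h6 : x 0 = ξ 0 + ζ 0 := hxt 0
      simp only [initialData, evalAt_apply, ← hq, h5, h6, add_sub_cancel_right]

theorem contDiff_initialData (hlam : 0 < lam) (hμ : 0 < μ) (h : IsTame ρ ρ') :
    ContDiff ℝ 1 (initialData hlam hμ h) := by
  have h1 : ContDiff ℝ 1 fun x => evalAt 0 (perron hlam hμ (h.superpose x)) :=
    ((evalAt 0).comp (perron hlam hμ)).contDiff.comp h.contDiff_superpose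
  exact ((evalAt 0).contDiff.sub h1).prodMk h1

theorem fderiv_initialData (hlam : 0 < lam) (hμ : 0 < μ) (h : IsTame ρ ρ') (x v : C₀(ℝ≥0, ℝ)) :
    fderiv ℝ (initialData hlam hμ h) x v =
      (v 0 - perron hlam hμ (h.superposeDeriv x * v) 0,
        perron hlam hμ (h.superposeDeriv x * v) 0) := by
  have h1 := ((evalAt 0).comp (perron hlam hμ)).hasFDerivAt.comp x (h.hasFDerivAt_superpose x)
  have h2 := ((evalAt 0).hasFDerivAt (x := x).sub h1).prodMk h1
  have h3 : HasFDerivAt (initialData hlam hμ h) _ x := h2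
  rw [h3.fderiv]
  rfl

/-- The difference of two solutions with equal data satisfies the linear equation with forcing
bounded by a Lipschitz constant of `ρ` on a ball containing both. -/
theorem injOn_initialData (hlam : 0 < lam) (hμ : 0 < μ) (h : IsTame ρ ρ') :
    InjOn (initialData hlam hμ h) (decayingSolutions hlam hμ h) := by
  rintro x ⟨a, ha⟩ y ⟨b, hb⟩ hxy
  obtain ⟨C, hC⟩ := h.bound (max ‖x‖ ‖y‖)
  simp only [initialData, evalAt_apply, Prod.mk.injEq] at hxy
  obtain ⟨h1, h2⟩ := hxy
  refine sub_eq_zero.1 (eq_zero_of_eq_perron_add hlam hμ (u := x - y)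
    (q := h.superpose x - h.superpose y) (c := a - b) (C := C) ?_ ?_ ?_ ?_)
  · conv_lhs => rw [ha, hb]
    rw [map_sub, zeroAtInfty_sub_smul]
    abel
  · rw [map_sub, ZeroAtInftyContinuousMap.sub_apply, ZeroAtInftyContinuousMap.sub_apply]
    linarith
  · rw [map_sub, ZeroAtInftyContinuousMap.sub_apply]
    linarith
  · intro t
    exact h.abs_sub_le hC t ((abs_apply_le_norm x t).trans (le_max_left _ _))
      ((abs_apply_le_norm y t).trans (le_max_right _ _))

/-- For every `T`, the map `y ↦ y - K_T N(y)` sends exactly the decaying solutions into `ℝ e`; at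
each `x` some `T` makes its derivative invertible. -/
theorem isImmersedCurve_decayingData (hlam : 0 < lam) (hμ : 0 < μ) (h : IsTame ρ ρ') :
    IsImmersedCurve (decayingData lam μ ρ) := by
  rw [← image_initialData hlam hμ h]
  refine isImmersedCurve_image_of_straightening (expDecay_ne_zero hlam)
    (contDiff_initialData hlam hμ h) (injOn_initialData hlam hμ h) fun x _ => ?_
  obtain ⟨T, u, hu⟩ := exists_isUnit_one_sub_perronFrom hlam hμ (h.superposeDeriv x)
  refine ⟨fun y => y - perronFrom hlam hμ T (h.superpose y), ContinuousLinearEquiv.ofUnit u,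
    contDiff_id.sub ((perronFrom hlam hμ T).contDiff.comp h.contDiff_superpose), ?_, ?_, ?_⟩
  · intro y
    constructor
    · rintro ⟨a, ha⟩
      refine ⟨a - expMoment hlam T (h.superpose y), ?_⟩
      dsimp only
      rw [perronFrom_eq, zeroAtInfty_sub_smul, sub_eq_iff_eq_add]
      nth_rewrite 1 [ha]
      abel
    · rintro ⟨a, ha⟩
      refine ⟨a + expMoment hlam T (h.superpose y), ?_⟩
      dsimp only at ha
      rw [perronFrom_eq, sub_eq_iff_eq_add] at ha
      rw [zeroAtInfty_add_smul]
      nth_rewrite 1 [ha]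
      abel
  · have h1 := (perronFrom hlam hμ T).hasFDerivAt.comp x (h.hasFDerivAt_superpose x)
    have h2 := (hasFDerivAt_id x).sub h1
    have e1 : ((ContinuousLinearEquiv.ofUnit u : C₀(ℝ≥0, ℝ) ≃L[ℝ] C₀(ℝ≥0, ℝ)) :
        C₀(ℝ≥0, ℝ) →L[ℝ] C₀(ℝ≥0, ℝ)) = (u : C₀(ℝ≥0, ℝ) →L[ℝ] C₀(ℝ≥0, ℝ)) := rfl
    rw [e1, hu]
    exact h2
  -- The tangent vector `v = A⁻¹ e` is a decaying solution of the linearized equation. Were its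
  -- initial data zero, uniqueness would give `v = 0`, hence `e = 0`.
  · set A := ContinuousLinearEquiv.ofUnit u
    set v := A.symm (expDecay hlam) with hv
    intro hzero
    rw [fderiv_initialData, Prod.mk_eq_zero] at hzero
    have hAv : A v = expDecay hlam := A.apply_symm_apply _
    have e1 : A v = v - perronFrom hlam hμ T (h.superposeDeriv x * v) := by
      change (u : C₀(ℝ≥0, ℝ) →L[ℝ] C₀(ℝ≥0, ℝ)) v = _
      rw [hu]
      rfl
    have hv0 : v = 0 := by
      refine eq_zero_of_eq_perron_add hlam hμ (q := h.superposeDeriv x * v)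
        (c := 1 + expMoment hlam T (h.superposeDeriv x * v)) (C := ‖h.superposeDeriv x‖)
        ?_ (sub_eq_zero.1 hzero.1) hzero.2 fun t => ?_
      · rw [hAv, perronFrom_eq] at e1
        rw [eq_sub_iff_add_eq] at e1
        rw [zeroAtInfty_add_smul, one_smul]
        conv_lhs => rw [← e1]
        abel
      · rw [ZeroAtInftyContinuousMap.mul_apply, abs_mul]
        exact mul_le_mul_of_nonneg_right (abs_apply_le_norm _ t) (abs_nonneg _)
    rw [hv0, map_zero] at hAv
    exact expDecay_ne_zero hlam hAv.symm

theorem zero_mem_decayingData (lam μ : ℝ) (h : IsTame ρ ρ') :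
    (0 : ℝ × ℝ) ∈ decayingData lam μ ρ := by
  refine ⟨fun _ => 0, fun _ => 0, fun t _ => ?_, fun t _ => ?_, tendsto_const_nhds,
    tendsto_const_nhds, rfl⟩
  · simpa [h.zero] using hasDerivWithinAt_const t (Ici 0) (0 : ℝ)
  · simpa [h.zero] using hasDerivWithinAt_const t (Ici 0) (0 : ℝ)

end Saddle

/-! ### Reduction of the Fowler system to a perturbed saddle -/

section Application

/-- The critical exponents are `2 + 4 / (n - 2 ± d)` with `d = discr n κ`, so they bound `α_l` by
`(n - 2 ± d) / 2`. The limiting matrix has eigenvalues `α_l - (n - 2) / 2 ± d / 2`, and the estimate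
says they have opposite signs. -/
theorem abs_alphaL_sub_lt {n : ℕ} (hn : 2 < n) {κ l : ℝ} (hκ : κ < ((n : ℝ) - 2) ^ 2 / 4)
    (hl : lowerExp n κ < l) (hu : (l : EReal) < upperExp n κ) :
    0 < discr n κ ∧ discr n κ ^ 2 = ((n : ℝ) - 2) ^ 2 - 4 * κ ∧
      |alphaL l - ((n : ℝ) - 2) / 2| < discr n κ / 2 := by
  have hn' : (2 : ℝ) < n := by exact_mod_cast hn
  have hpos : 0 < ((n : ℝ) - 2) ^ 2 - 4 * κ := by linarith
  have hd : 0 < discr n κ := Real.sqrt_pos.2 hpos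
  have hd2 : discr n κ ^ 2 = ((n : ℝ) - 2) ^ 2 - 4 * κ := Real.sq_sqrt hpos.le
  refine ⟨hd, hd2, ?_⟩
  rw [upperExp] at hu
  rw [lowerExp] at hl
  rw [alphaL]
  set d := discr n κ
  have hden : 0 < (n : ℝ) - 2 + d := by linarith
  have e1 : 2 * (((n : ℝ) + d) / (n - 2 + d)) = 2 + 4 / (n - 2 + d) := by
    field_simp
    ring
  rw [e1] at hl
  have hl2 : 0 < l - 2 := by
    have : 0 < 4 / ((n : ℝ) - 2 + d) := by positivity
    linarith
  have k1 : 4 < (l - 2) * (n - 2 + d) := by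
    rw [← div_lt_iff₀ hden]
    linarith
  have hα : 0 < 2 / (l - 2) := by positivity
  rw [abs_lt]
  constructor
  -- For `κ ≤ 0` there is no upper exponent, but then `d ≥ n - 2` and the lower bound follows from
  -- `α_l > 0`.
  · rcases le_or_gt κ 0 with h0 | h0
    · have : (n : ℝ) - 2 ≤ d := by
        apply le_of_sq_le_sq _ hd.le
        linarith
      linarith
    · rw [if_neg (not_le.2 h0), EReal.coe_lt_coe_iff] at hu
      have hdn : d < n - 2 := by
        apply lt_of_pow_lt_pow_left₀ 2 (by linarith)
        linarith
      have hden' : 0 < (n : ℝ) - 2 - d := by linarith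
      have e2 : 2 * (((n : ℝ) - d) / (n - 2 - d)) = 2 + 4 / (n - 2 - d) := by
        field_simp
        ring
      rw [e2] at hu
      have k2 : (l - 2) * (n - 2 - d) < 4 := by
        rw [← lt_div_iff₀ hden']
        linarith
      have : ((n : ℝ) - 2 - d) / 2 < 2 / (l - 2) := by
        rw [div_lt_div_iff₀ (by norm_num) hl2]
        linarith
      linarith
  · have : 2 / (l - 2) < ((n : ℝ) - 2 + d) / 2 := by
      rw [div_lt_div_iff₀ hl2 (by norm_num)]
      linarith
    linarith

/-- Go from `0` to `x` in `n` equal steps shorter than `δ`, with `n` independent of `t`; each step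
changes `G` by less than `1`. -/
theorem ContUniformlyInTime.exists_bound {G : ℝ → ℝ → ℝ} {T : Set ℝ}
    (hG : ContUniformlyInTime G T) (h0 : ∀ t, G 0 t = 0) (R : ℝ) :
    ∃ C, ∀ t ∈ T, ∀ x, |x| ≤ R → |G x t| ≤ C := by
  obtain ⟨δ, hδ, H⟩ := hG (Icc (-R) R) isCompact_Icc 1 one_pos
  obtain ⟨n, hn⟩ := exists_nat_gt (R / δ)
  refine ⟨n, fun t ht x hx => ?_⟩
  rcases Nat.eq_zero_or_pos n with rfl | hn0
  · rw [Nat.cast_zero, div_lt_iff₀ hδ, zero_mul] at hn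
    linarith [abs_nonneg x]
  have hn0' : (0 : ℝ) < n := by exact_mod_cast hn0
  have hstep : |x / n| < δ := by
    rw [abs_div, Nat.abs_cast, div_lt_iff₀ hn0']
    rw [div_lt_iff₀ hδ] at hn
    linarith
  have hmem : ∀ k : ℕ, k ≤ n → (k : ℝ) * (x / n) ∈ Icc (-R) R := by
    intro k hk
    rw [mem_Icc, ← abs_le, abs_mul, Nat.abs_cast, abs_div, Nat.abs_cast, mul_div_left_comm]
    have : (k : ℝ) / n ≤ 1 := (div_le_one hn0').2 (by exact_mod_cast hk)
    exact (mul_le_of_le_one_right (abs_nonneg x) this).trans hx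
  have key : ∀ k : ℕ, k ≤ n → |G (k * (x / n)) t| ≤ k := by
    intro k
    induction k with
    | zero => intro _; simp [h0]
    | succ k ih =>
      intro hk
      have h1 := H t ht _ (hmem (k + 1) hk) _ (hmem k (by omega)) (by
        push_cast
        rw [add_mul, one_mul, add_sub_cancel_left]
        exact hstep)
      have h2 := abs_sub_abs_le_abs_sub (G (((k + 1 : ℕ) : ℝ) * (x / n)) t) (G (k * (x / n)) t)
      have h3 := ih (by omega)
      push_cast at h1 h2 ⊢
      linarith
  have := key n le_rfl
  rwa [mul_div_cancel₀ _ hn0'.ne'] at this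

variable {f : ℝ → ℝ → ℝ}

theorem RegularF.hasDerivAt_gL (hf : RegularF f) (l x t : ℝ) :
    HasDerivAt (fun ξ => gL f l ξ t) (dgL f l x t) x := by
  refine DifferentiableAt.hasDerivAt ?_
  have h1 := hf.differentiable (Real.exp t) (Real.exp_pos t)
  have h2 : Differentiable ℝ fun ξ : ℝ => f (ξ * Real.exp (-alphaL l * t)) (Real.exp t) :=
    h1.comp (differentiable_id.mul_const _)
  exact (h2.mul_const _) x

theorem RegularF.continuous_gL (hf : RegularF f) (l : ℝ) :
    Continuous fun p : ℝ × ℝ => gL f l p.2 p.1 := by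
  have h1 : Continuous fun p : ℝ × ℝ =>
      f (p.2 * Real.exp (-alphaL l * p.1)) (Real.exp p.1) :=
    hf.continuous.comp_continuous
      (f := fun p : ℝ × ℝ => (p.2 * Real.exp (-alphaL l * p.1), Real.exp p.1)) (by fun_prop)
      fun p => ⟨mem_univ _, Real.exp_pos p.1⟩
  exact h1.mul (by fun_prop)

/-- The perturbation of the limiting linear saddle, along the times `σ(s)`. -/
noncomputable def saddlePerturbation (h : ℝ → ℝ) (f : ℝ → ℝ → ℝ) (l κ d : ℝ) (σ : ℝ → ℝ)
    (s : ℝ≥0) (x : ℝ) : ℝ :=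
  ((κ - h (Real.exp (σ s))) * x - gL f l x (σ s)) / d

theorem isTame_saddlePerturbation (hf : RegularF f) {h : ℝ → ℝ}
    (hh : DifferentiableOn ℝ h (Ioi 0)) {l κ d : ℝ} (hd : 0 < d) {σ : ℝ → ℝ} {T : Set ℝ}
    (hσ : Continuous σ) (hσT : ∀ s, 0 ≤ s → σ s ∈ T)
    (hlim : Tendsto (fun s => h (Real.exp (σ s))) atTop (𝓝 κ))
    (hunif : ContUniformlyInTime (dgL f l) T) (hzero : ∀ t, gL f l 0 t = 0)
    (hderiv : ∀ t, dgL f l 0 t = 0) :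
    IsTame (saddlePerturbation h f l κ d σ)
      (fun s x => ((κ - h (Real.exp (σ s))) - dgL f l x (σ s)) / d) := by
  have hcont : Continuous fun s => h (Real.exp (σ s)) :=
    hh.continuousOn.comp_continuous (Real.continuous_exp.comp hσ) fun s => Real.exp_pos _
  have hlim0 : Tendsto (fun s => κ - h (Real.exp (σ s))) atTop (𝓝 0) := by
    simpa using hlim.const_sub κ
  constructor
  · have h1 : Continuous fun p : ℝ≥0 × ℝ => gL f l p.2 (σ p.1) :=
      (hf.continuous_gL l).comp (f := fun p : ℝ≥0 × ℝ => (σ p.1, p.2)) (by fun_prop)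
    have h2 : Continuous fun p : ℝ≥0 × ℝ => h (Real.exp (σ p.1)) :=
      hcont.comp (f := fun p : ℝ≥0 × ℝ => (p.1 : ℝ)) (by fun_prop)
    exact (((continuous_const.sub h2).mul continuous_snd).sub h1).div_const d
  · intro t x
    have h1 := (((hasDerivAt_id x).const_mul (κ - h (Real.exp (σ t)))).sub
      (hf.hasDerivAt_gL l x (σ t))).div_const d
    rw [mul_one] at h1
    exact h1
  · intro t
    simp [saddlePerturbation, hzero]
  · have : Tendsto (fun s : ℝ≥0 => (κ - h (Real.exp (σ s))) / d) atTop (𝓝 0) := by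
      simpa using (hlim0.comp (NNReal.tendsto_coe_atTop.2 tendsto_id)).div_const d
    simpa [hderiv] using this
  · intro R
    obtain ⟨C, hC⟩ := hunif.exists_bound hderiv R
    -- Viewed in `C₀`, this coefficient is bounded by its norm.
    set p := ofTendsto (fun s => κ - h (Real.exp (σ s)))
      (continuous_const.sub hcont).continuousOn hlim0
    refine ⟨(‖p‖ + C) / d, fun t x hx => ?_⟩
    rw [abs_div, abs_of_pos hd]
    refine div_le_div_of_nonneg_right ((abs_sub _ _).trans (add_le_add ?_ ?_)) hd.le
    · exact abs_apply_le_norm p t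
    · exact hC _ (hσT t t.2) x hx
  · intro R ε hε
    obtain ⟨δ, hδ, H⟩ := hunif (Icc (-R) R) isCompact_Icc (ε * d) (by positivity)
    refine ⟨δ, hδ, fun t x y hx hy hxy => ?_⟩
    rw [← sub_div, sub_sub_sub_cancel_left, abs_div, abs_of_pos hd, div_lt_iff₀ hd, abs_sub_comm]
    exact H _ (hσT t t.2) x (abs_le.1 hx) y (abs_le.1 hy) hxy

/-- The change of coordinates `(ξ, ζ) ↦ ξ (1, a) + ζ (1, b)`. -/
noncomputable def eigenFrame (a b : ℝ) (hab : b - a ≠ 0) : (ℝ × ℝ) ≃L[ℝ] (ℝ × ℝ) :=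
  LinearEquiv.toContinuousLinearEquiv
    { toFun := fun p => (p.1 + p.2, a * p.1 + b * p.2)
      map_add' := fun p q => by
        ext
        · simp; ring
        · simp; ring
      map_smul' := fun c p => by
        ext
        · simp; ring
        · simp; ring
      invFun := fun p => ((b * p.1 - p.2) / (b - a), (p.2 - a * p.1) / (b - a))
      left_inv := fun p => by
        ext
        · field_simp; ring
        · field_simp; ring
      right_inv := fun p => by
        ext
        · field_simp; ring
        · field_simp; ring }

theorem eigenFrame_apply (a b : ℝ) (hab : b - a ≠ 0) (p : ℝ × ℝ) :
    eigenFrame a b hab p = (p.1 + p.2, a * p.1 + b * p.2) := rfl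

/-- Trajectories of the planar system that tend to the origin as time runs from `τ` in the
direction `ε = ±1`, in coordinates adapted to the limiting saddle. -/
theorem exists_trajectory_iff_mem_image_decayingData {n : ℕ} {h : ℝ → ℝ} {l τ ε lam μ κ : ℝ}
    (hε : ε * ε = 1) (hlam : 0 < lam) (hμ : 0 < μ)
    (htrace : ε * (μ - lam) = alphaL l + gammaL n l)
    (hdet : -(lam * μ) = alphaL l * gammaL n l + κ) {I : Set ℝ}
    (hI : ∀ t, t ∈ I ↔ 0 ≤ ε * (t - τ))
    (hab : (ε * μ - alphaL l) - (-(ε * lam) - alphaL l) ≠ 0) (Q : ℝ × ℝ) :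
    (∃ z : ℝ → ℝ × ℝ, IsTrajectoryOn n h f l I z ∧ z τ = Q ∧
      Tendsto (fun s => z (τ + ε * s)) atTop (𝓝 0)) ↔
    Q ∈ eigenFrame (-(ε * lam) - alphaL l) (ε * μ - alphaL l) hab ''
      decayingData lam μ (saddlePerturbation h f l κ (lam + μ) fun s => τ + ε * s) := by
  -- Trace and determinant say that the limiting matrix has eigenvalues `ε μ` and `-ε λ`;
  -- eliminating `γ_l` and `κ` reduces the later checks to algebra with `ε² = 1`.
  have hγ : gammaL n l = ε * (μ - lam) - alphaL l := by linarith
  have hκ : κ = -(lam * μ) - alphaL l * (ε * (μ - lam) - alphaL l) := by rw [← hγ]; linarith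
  have hd : lam + μ ≠ 0 := by positivity
  set α := alphaL l
  have hback : ∀ s, ε * (τ + ε * s - τ) = s := fun s => by linear_combination s * hε
  constructor
  · rintro ⟨z, hz, rfl, hlim⟩
    set P := eigenFrame (-(ε * lam) - α) (ε * μ - α) hab with hP
    have hZ : ∀ s, 0 ≤ s → HasDerivWithinAt (fun s => z (τ + ε * s))
        (ε • field n h f l (τ + ε * s) (z (τ + ε * s))) (Ici 0) s := by
      intro s hs
      have h1 : HasDerivWithinAt (fun s => τ + ε * s) ε (Ici 0) s := by
        simpa using (((hasDerivAt_id s).const_mul ε).const_add τ).hasDerivWithinAt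
      exact (hz (τ + ε * s) ((hI _).2 (by rw [hback]; exact hs))).scomp s h1
        fun r hr => (hI _).2 (by rw [hback]; exact hr)
    set x : ℝ → ℝ := fun s => (z (τ + ε * s)).1 with hx
    set y : ℝ → ℝ := fun s => (z (τ + ε * s)).2 with hy
    have hx' : ∀ s, 0 ≤ s → HasDerivWithinAt x (ε * (α * x s + y s)) (Ici 0) s :=
      fun s hs => (hZ s hs).fst
    have hy' : ∀ s, 0 ≤ s → HasDerivWithinAt y
        (ε * (-h (Real.exp (τ + ε * s)) * x s + gammaL n l * y s
          - gL f l (x s) (τ + ε * s))) (Ici 0) s :=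
      fun s hs => (hZ s hs).snd
    have hxl : Tendsto x atTop (𝓝 0) := (continuous_fst.tendsto _).comp hlim
    have hyl : Tendsto y atTop (𝓝 0) := (continuous_snd.tendsto _).comp hlim
    -- Coordinates along the eigenvectors `(1, ν - α)`, `ν = -ε λ` and `ν = ε μ`; the determinant of
    -- the frame is `ε (λ + μ)` and `1/ε = ε`.
    set ξ : ℝ → ℝ := fun s => ε * ((ε * μ - α) * x s - y s) / (lam + μ) with hξ
    set ζ : ℝ → ℝ := fun s => ε * (y s - (-(ε * lam) - α) * x s) / (lam + μ) with hζ
    have hadd : ∀ s, ξ s + ζ s = x s := by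
      intro s
      simp only [hξ, hζ]
      rw [← add_div, div_eq_iff hd]
      linear_combination x s * (lam + μ) * hε
    refine ⟨(ξ 0, ζ 0), ⟨ξ, ζ, fun s hs => ?_, fun s hs => ?_, ?_, ?_, rfl⟩, ?_⟩
    · rw [hadd]
      convert! ((((hx' s hs).const_mul (ε * μ - α)).sub (hy' s hs)).const_mul ε).div_const
        (lam + μ) using 1
      simp only [saddlePerturbation, Real.coe_toNNReal s hs, hξ]
      field_simp
      rw [hγ, hκ]
      generalize h (Real.exp (τ + ε * s)) = H
      generalize gL f l (x s) (τ + ε * s) = G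
      have e2 : ε ^ 2 = 1 := by rw [sq, hε]
      have e3 : ε ^ 3 = ε := by rw [pow_succ, e2, one_mul]
      ring_nf
      rw [e3, e2]
      ring
    · rw [hadd]
      convert! (((hy' s hs).sub ((hx' s hs).const_mul (-(ε * lam) - α))).const_mul ε).div_const
        (lam + μ) using 1
      simp only [saddlePerturbation, Real.coe_toNNReal s hs, hζ]
      field_simp
      rw [hγ, hκ]
      generalize h (Real.exp (τ + ε * s)) = H
      generalize gL f l (x s) (τ + ε * s) = G
      have e2 : ε ^ 2 = 1 := by rw [sq, hε]
      have e3 : ε ^ 3 = ε := by rw [pow_succ, e2, one_mul]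
      ring_nf
      rw [e3, e2]
      ring
    · simpa using (((hxl.const_mul (ε * μ - α)).sub hyl).const_mul ε).div_const (lam + μ)
    · simpa using ((hyl.sub (hxl.const_mul (-(ε * lam) - α))).const_mul ε).div_const (lam + μ)
    · have e1 : z τ = (x 0, y 0) := by simp [hx, hy]
      rw [e1, hP, eigenFrame_apply]
      refine Prod.ext (hadd 0) ?_
      simp only [hξ, hζ]
      field_simp
      have e2 : ε ^ 2 = 1 := by rw [sq, hε]
      ring_nf
      rw [e2]
      ring
  · rintro ⟨-, ⟨ξ, ζ, hξ, hζ, hξl, hζl, rfl⟩, rfl⟩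
    set P := eigenFrame (-(ε * lam) - α) (ε * μ - α) hab with hP
    refine ⟨fun t => P (ξ (ε * (t - τ)), ζ (ε * (t - τ))), ?_, by simp, ?_⟩
    · intro t ht
      have hs : 0 ≤ ε * (t - τ) := (hI t).1 ht
      have h1 : HasDerivWithinAt (fun t => ε * (t - τ)) ε I t := by
        simpa using (((hasDerivAt_id t).sub_const τ).const_mul ε).hasDerivWithinAt
      have hmaps : MapsTo (fun t => ε * (t - τ)) I (Ici 0) := fun r hr => (hI r).1 hr
      have h2 := (hξ _ hs).comp t h1 hmaps
      have h3 := (hζ _ hs).comp t h1 hmaps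
      have h4 := P.hasFDerivAt.comp_hasDerivWithinAt t (h2.prodMk h3)
      convert! h4 using 1
      have hret : τ + ε * (ε * (t - τ)) = t := by linear_combination (t - τ) * hε
      simp only [hP, eigenFrame_apply, ContinuousLinearEquiv.coe_coe, field, saddlePerturbation,
        Real.coe_toNNReal _ hs, hret]
      set a := ξ (ε * (t - τ))
      set b := ζ (ε * (t - τ))
      have e2 : ε ^ 2 = 1 := by rw [sq, hε]
      refine Prod.ext ?_ ?_
      · change α * (a + b) + ((-(ε * lam) - α) * a + (ε * μ - α) * b) = _
        ring
      · simp only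
        field_simp
        rw [hγ, hκ]
        generalize h (Real.exp t) = H
        generalize gL f l (a + b) t = G
        have e3 : ε ^ 3 = ε := by rw [pow_succ, e2, one_mul]
        ring_nf
        rw [e3, e2]
        ring
    · have h1 : ∀ s, P (ξ (ε * (τ + ε * s - τ)), ζ (ε * (τ + ε * s - τ))) = P (ξ s, ζ s) :=
        fun s => by rw [hback]
      simp only [h1]
      have h2 : Tendsto (fun s => (ξ s, ζ s)) atTop (𝓝 ((0 : ℝ), (0 : ℝ))) :=
        hξl.prodMk_nhds hζl
      have h3 := (P.continuous.tendsto ((0 : ℝ), (0 : ℝ))).comp h2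
      have h4 : P ((0 : ℝ), (0 : ℝ)) = 0 := map_zero P
      rw [h4] at h3
      exact h3

end Application

section Application

/-- The set of initial data at time `τ` of the trajectories that tend to the origin in the time
direction `ε = ±1` is an immersed curve through the origin. -/
theorem isImmersedCurve_of_saddle {n : ℕ} {h : ℝ → ℝ} {f : ℝ → ℝ → ℝ} {l τ ε lam μ κ : ℝ}
    (hf : RegularF f) (hh : DifferentiableOn ℝ h (Ioi 0))
    (hε : ε * ε = 1) (hlam : 0 < lam) (hμ : 0 < μ)
    (htrace : ε * (μ - lam) = alphaL l + gammaL n l)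
    (hdet : -(lam * μ) = alphaL l * gammaL n l + κ) {I : Set ℝ}
    (hI : ∀ t, t ∈ I ↔ 0 ≤ ε * (t - τ))
    (hlim : Tendsto (fun s => h (Real.exp (τ + ε * s))) atTop (𝓝 κ))
    (hunif : ContUniformlyInTime (dgL f l) I) (hzero : ∀ t, gL f l 0 t = 0)
    (hderiv : ∀ t, dgL f l 0 t = 0) {S : Set (ℝ × ℝ)}
    (hS : ∀ Q, Q ∈ S ↔ ∃ z : ℝ → ℝ × ℝ, IsTrajectoryOn n h f l I z ∧ z τ = Q ∧
      Tendsto (fun s => z (τ + ε * s)) atTop (𝓝 0)) :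
    IsImmersedCurve S ∧ (0 : ℝ × ℝ) ∈ S := by
  have hab : (ε * μ - alphaL l) - (-(ε * lam) - alphaL l) ≠ 0 := by
    have hε0 : ε ≠ 0 := by rintro rfl; simp at hε
    have : (ε * μ - alphaL l) - (-(ε * lam) - alphaL l) = ε * (lam + μ) := by ring
    rw [this]
    exact mul_ne_zero hε0 (by positivity)
  have tame := isTame_saddlePerturbation (l := l) hf hh (add_pos hlam hμ)
    (σ := fun s => τ + ε * s) (by fun_prop) (T := I)
    (fun s hs => (hI _).2 (by
      have : ε * (τ + ε * s - τ) = s := by linear_combination s * hε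
      rwa [this])) hlim hunif hzero hderiv
  have hSeq : S = eigenFrame (-(ε * lam) - alphaL l) (ε * μ - alphaL l) hab ''
      decayingData lam μ (saddlePerturbation h f l κ (lam + μ) fun s => τ + ε * s) := by
    ext Q
    rw [hS Q, exists_trajectory_iff_mem_image_decayingData hε hlam hμ htrace hdet hI hab Q]
  rw [hSeq]
  exact ⟨(isImmersedCurve_decayingData hlam hμ tame).image_continuousLinearEquiv _,
    0, zero_mem_decayingData lam μ tame, map_zero _⟩

variable {n : ℕ} {h : ℝ → ℝ} {f : ℝ → ℝ → ℝ} {η β l : ℝ}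

theorem isImmersedCurve_stableSet (hn : 2 < n) (hf : RegularF f) (hH : HypH n h η β)
    (hg : HypGs n f β l) (τ : ℝ) :
    IsImmersedCurve (stableSet n h f l τ) ∧ (0 : ℝ × ℝ) ∈ stableSet n h f l τ := by
  obtain ⟨hd, hd2, habs⟩ := abs_alphaL_sub_lt hn hH.beta_lt hg.lower hg.upper
  obtain ⟨h1, h2⟩ := abs_lt.1 habs
  have hσ : Tendsto (fun s : ℝ => τ + 1 * s) atTop atTop := by
    simpa using tendsto_atTop_add_const_left atTop τ tendsto_id
  refine isImmersedCurve_of_saddle (τ := τ) (ε := 1) (I := Ici τ)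
    (lam := discr n β / 2 - (alphaL l - ((n : ℝ) - 2) / 2))
    (μ := discr n β / 2 + (alphaL l - ((n : ℝ) - 2) / 2)) (κ := β) hf hH.differentiable
    (by norm_num) (by linarith) (by linarith) (by rw [gammaL]; ring)
    (by rw [gammaL]; linear_combination -hd2 / 4) (fun t => by rw [mem_Ici, one_mul, sub_nonneg])
    (hH.tendsto_infty.comp (Real.tendsto_exp_atTop.comp hσ)) (hg.unif_deriv τ) hg.zero
    hg.deriv_zero fun Q => ⟨?_, ?_⟩
  · rintro ⟨z, hz, hQ, hlim⟩
    exact ⟨z, hz, hQ, hlim.comp hσ⟩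
  · rintro ⟨z, hz, hQ, hlim⟩
    refine ⟨z, hz, hQ, ?_⟩
    have hσ' : Tendsto (fun t : ℝ => t + -τ) atTop atTop :=
      tendsto_atTop_add_const_right atTop (-τ) tendsto_id
    refine (hlim.comp hσ').congr fun t => ?_
    simp

/-- Reversing time negates the eigenvalues, so the rates `λ` and `μ` trade places compared with the
stable case, and the limit is that of `h` at `0`. -/
theorem isImmersedCurve_unstableSet (hn : 2 < n) (hf : RegularF f) (hH : HypH n h η β)
    (hg : HypGu n f η l) (τ : ℝ) :
    IsImmersedCurve (unstableSet n h f l τ) ∧ (0 : ℝ × ℝ) ∈ unstableSet n h f l τ := by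
  obtain ⟨hd, hd2, habs⟩ := abs_alphaL_sub_lt hn hH.eta_lt hg.lower hg.upper
  obtain ⟨h1, h2⟩ := abs_lt.1 habs
  have hσ : Tendsto (fun s : ℝ => τ + -1 * s) atTop atBot := by
    simpa using tendsto_atBot_add_const_left atTop τ tendsto_neg_atTop_atBot
  have hexp : Tendsto Real.exp atBot (𝓝[>] 0) := Real.tendsto_exp_atBot_nhdsGT
  refine isImmersedCurve_of_saddle (τ := τ) (ε := -1) (I := Iic τ)
    (lam := discr n η / 2 + (alphaL l - ((n : ℝ) - 2) / 2))
    (μ := discr n η / 2 - (alphaL l - ((n : ℝ) - 2) / 2)) (κ := η) hf hH.differentiable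
    (by norm_num) (by linarith) (by linarith) (by rw [gammaL]; ring)
    (by rw [gammaL]; linear_combination -hd2 / 4)
    (fun t => by rw [mem_Iic, neg_one_mul, neg_sub, sub_nonneg])
    (hH.tendsto_zero.comp (hexp.comp hσ)) (hg.unif_deriv τ) hg.zero
    hg.deriv_zero fun Q => ⟨?_, ?_⟩
  · rintro ⟨z, hz, hQ, hlim⟩
    exact ⟨z, hz, hQ, hlim.comp hσ⟩
  · rintro ⟨z, hz, hQ, hlim⟩
    refine ⟨z, hz, hQ, ?_⟩
    have hσ' : Tendsto (fun t : ℝ => τ + -t) atBot atTop :=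
      tendsto_atTop_add_const_left atBot τ tendsto_neg_atBot_atTop
    refine (hlim.comp hσ').congr fun t => ?_
    simp

end Application

end Fowler

theorem lemma2p6 (n : ℕ) (hn : 2 < n) (h : ℝ → ℝ) (f : ℝ → ℝ → ℝ) (η β lu ls : ℝ)
    (hf : Fowler.RegularF f) (hH : Fowler.HypH n h η β)
    (hgu : Fowler.HypGu n f η lu) (hgs : Fowler.HypGs n f β ls) :
    ∀ τ : ℝ,
      ((0 : ℝ × ℝ) ∈ Fowler.unstableManifold n h f lu τ ∧
        IsConnected (Fowler.unstableManifold n h f lu τ) ∧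
        Fowler.unstableManifold n h f lu τ ⊆ Fowler.unstableSet n h f lu τ ∧
        Fowler.IsImmersedCurve (Fowler.unstableManifold n h f lu τ) ∧
        ∃ W ⊆ Fowler.unstableManifold n h f lu τ,
          (0 : ℝ × ℝ) ∈ W ∧ Fowler.IsConnectedImmersedCurve W) ∧
      ((0 : ℝ × ℝ) ∈ Fowler.stableManifold n h f ls τ ∧
        IsConnected (Fowler.stableManifold n h f ls τ) ∧
        Fowler.stableManifold n h f ls τ ⊆ Fowler.stableSet n h f ls τ ∧
        Fowler.IsImmersedCurve (Fowler.stableManifold n h f ls τ) ∧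
        ∃ W ⊆ Fowler.stableManifold n h f ls τ,
          (0 : ℝ × ℝ) ∈ W ∧ Fowler.IsConnectedImmersedCurve W) := by
  intro τ
  obtain ⟨hu, hu0⟩ := Fowler.isImmersedCurve_unstableSet hn hf hH hgu τ
  obtain ⟨hs, hs0⟩ := Fowler.isImmersedCurve_stableSet hn hf hH hgs τ
  obtain ⟨hu1, hu2⟩ := hu.connectedComponentIn hu0
  obtain ⟨hs1, hs2⟩ := hs.connectedComponentIn hs0
  exact ⟨⟨mem_connectedComponentIn hu0, isConnected_connectedComponentIn_iff.2 hu0,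
      connectedComponentIn_subset _ _, hu1, hu2⟩,
    mem_connectedComponentIn hs0, isConnected_connectedComponentIn_iff.2 hs0,
    connectedComponentIn_subset _ _, hs1, hs2⟩
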